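/- Let $T\subset\mathbb R$ be open, let $z_1,\dots,z_m:T\to\mathbb C$ be continuously differentiable and $\rho_1,\dots,\rho_m\in\mathbb C$. Assume that a singularity located at the origin is at rest ($z_j(t)=0$ implies $\dot z_j(t)=0$; the corresponding terms $\dot z_j/z_j$ below are then read as $0$) and that $\operatorname{Re}\rho_j>0$ whenever $|z_j(t)|=1$ for some $t\in T$. For $t\in T$ let $w(\cdot)=w(t;\cdot)$ be a weight $$w(z)=\prod_{j=1}^m (z-z_j(t))^{\rho_j}$$ on the unit circle $\mathbb T$, in the following sense: away from the points $z_j(t)$ and from a finite set of fixed cut points on $\mathbb T$, $w$ is, jointly in $(t,\zeta)$, locally a constant multiple of an analytic branch of the product, and locally uniformly in $t$ one has $|w(t;\zeta)|\le C\prod_j|\zeta-z_j(t)|^{\operatorname{Re}\rho_j}$ on $\mathbb T$. Suppose that for each $t\in T$ there is a bi-orthonormal system of polynomials $\phi_n,\bar\phi_n$ ($n\ge 0$) of degree $n$, $$\int_{\mathbb T}\frac{d\zeta}{2\pi i\zeta}\,w(\zeta)\phi_k(\zeta)\bar\phi_n(\bar\zeta)=\delta_{k,n},$$ where $\phi_n$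 and $\bar\phi_n$ have the same leading coefficient $\kappa_n$, chosen continuously in $t$ ($\bar\phi_n$ need not be the complex conjugate of $\phi_n$). Put $\phi^*_n(z)=z^n\bar\phi_n(1/z)$, $F(z)=\int_{\mathbb T}\frac{d\zeta}{2\pi i\zeta}\frac{\zeta+z}{\zeta-z}w(\zeta)$, and $$\epsilon_n=\psi_n+F\phi_n,\qquad \epsilon^*_n=\psi^*_n-F\phi^*_n,$$ where $\psi_0=\psi^*_0=1/\kappa_0$ and, for $n\ge1$, $$\psi_n(z)=\int_{\mathbb T}\frac{d\zeta}{2\pi i\zeta}\frac{\zeta+z}{\zeta-z}w(\zeta)[\phi_n(\zeta)-\phi_n(z)],\quad \psi^*_n(z)=-\int_{\mathbb T}\frac{d\zeta}{2\pi i\zeta}\frac{\zeta+z}{\zeta-z}w(\zeta)[z^n\bar\phi_n(\bar\zeta)-\phi^*_n(z)].$$ Then for every $n\ge0$ and $t\in T$, $\kappa_n$ is differentiable at $t$ and, with $\dot{}=d/dt$ at fixed $z$, the following derivatives exist and satisfy: for every $z\in\mathbb C\setminus\{z_1(t),\dots,z_m(t)\}$, $$\dot\phi_n(z)=\Big\{-\frac{\dot\kappa_n}{\kappa_n}-\sum_{j}\rho_j\frac{\dot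 z_j}{z_j}+\frac12\sum_{j}\rho_j\frac{\dot z_j}{z_j}z_j^{-n}\epsilon_n(z_j)\phi^*_n(z_j)\frac{z}{z-z_j}\Big\}\phi_n(z)-\Big\{\frac12\sum_{j}\rho_j\frac{\dot z_j}{z_j}z_j^{1-n}\epsilon_n(z_j)\phi_n(z_j)\frac1{z-z_j}\Big\}\phi^*_n(z),$$ $$\dot\phi^*_n(z)=\Big\{-\frac{\dot\kappa_n}{\kappa_n}+\frac12\sum_{j}\rho_j\frac{\dot z_j}{z_j}z_j^{1-n}\epsilon^*_n(z_j)\phi_n(z_j)\frac1{z-z_j}\Big\}\phi^*_n(z)-\Big\{\frac12\sum_{j}\rho_j\frac{\dot z_j}{z_j}z_j^{-n}\epsilon^*_n(z_j)\phi^*_n(z_j)\frac z{z-z_j}\Big\}\phi_n(z),$$ and for every such $z$ with $|z|\ne1$, $$\dot\epsilon_n(z)=\Big\{-\frac{\dot\kappa_n}{\kappa_n}-\frac12\sum_{j}\rho_j\frac{\dot z_j}{z_j}z_j^{-n}\epsilon^*_n(z_j)\phi_n(z_j)\frac z{z-z_j}\Big\}\epsilon_n(z)+\Big\{\frac12\sum_{j}\rho_j\frac{\dot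 z_j}{z_j}z_j^{1-n}\epsilon_n(z_j)\phi_n(z_j)\frac1{z-z_j}\Big\}\epsilon^*_n(z),$$ $$\dot\epsilon^*_n(z)=\Big\{-\frac{\dot\kappa_n}{\kappa_n}-\frac12\sum_{j}\rho_j\frac{\dot z_j}{z_j}z_j^{1-n}\epsilon_n(z_j)\phi^*_n(z_j)\frac1{z-z_j}\Big\}\epsilon^*_n(z)+\Big\{\frac12\sum_{j}\rho_j\frac{\dot z_j}{z_j}z_j^{-n}\epsilon^*_n(z_j)\phi^*_n(z_j)\frac z{z-z_j}\Big\}\epsilon_n(z).$$ -/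

import Mathlib

open Filter Topology

noncomputable section

namespace BiorthUnitCircle

/-- `∫_𝕋 dζ / (2π i ζ) f(ζ)`, i.e. the mean of `f` over the unit circle. -/
def circleMean (f : ℂ → ℂ) : ℂ := Real.circleAverage f 0 1

/-- The weights `w t ζ = ∏ j, (ζ - z j t) ^ ρ j` on the unit circle, for `t` in an open set of times
`T`, with moving singularities `z j t`.  Complex powers are multivalued, so `w` is described as a
branch: away from the singularities and from a finite set `E` of fixed cut points on the circle
(such as `{-1}`), `w` is, jointly in `(t, ζ)`, locally a constant multiple of an analytic branch of
the product.  Different arcs between singularities and cut points may carry different constants. -/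
structure IsSemiclassicalDeformation {m : ℕ} (T : Set ℝ) (z : Fin m → ℝ → ℂ) (ρ : Fin m → ℂ)
    (w : ℝ → ℂ → ℂ) : Prop where
  /-- the trajectories of the singularities are continuously differentiable -/
  contDiffOn : ∀ j, ContDiffOn ℝ 1 (z j) T
  /-- a singularity located at the origin is at rest -/
  rest_at_zero : ∀ j, ∀ t ∈ T, z j t = 0 → deriv (z j) t = 0
  /-- for singularities on the circle the exponent has positive real part, which is the condition
  for `w` and its derivative to be integrable there -/
  re_pos : ∀ j, ∀ t ∈ T, ‖z j t‖ = 1 → 0 < (ρ j).re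
  /-- `w` is locally a constant multiple of a branch of the product; the principal power below is
  applied to a number close to `1` -/
  branch : ∃ E : Set ℂ, E.Finite ∧ ∀ t₀ ∈ T, ∀ ζ₀ : ℂ, ‖ζ₀‖ = 1 → ζ₀ ∉ E → (∀ j, ζ₀ ≠ z j t₀) →
    ∀ᶠ p : ℝ × ℂ in 𝓝 t₀ ×ˢ 𝓝[Metric.sphere 0 1] ζ₀,
      w p.1 p.2 = w t₀ ζ₀ * ∏ j, ((p.2 - z j p.1) / (ζ₀ - z j t₀)) ^ ρ j
  /-- the branches (arguments and constants) stay bounded, locally uniformly in time; in particular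
  `w` vanishes at the singularities that lie on the circle -/
  bounded : ∀ t₀ ∈ T, ∃ C : ℝ, ∀ᶠ t in 𝓝 t₀, ∀ ζ : ℂ, ‖ζ‖ = 1 →
    ‖w t ζ‖ ≤ C * ∏ j, ‖ζ - z j t‖ ^ (ρ j).re

/-- `φ n`, `φbar n` are the bi-orthonormal polynomials of the weight `w` on the unit circle,
normalised to have equal leading coefficients `κ n`. -/
structure IsBiorthonormalSystem (w : ℂ → ℂ) (φ φbar : ℕ → Polynomial ℂ) : Prop where
  natDegree_left : ∀ n, (φ n).natDegree = n
  natDegree_right : ∀ n, (φbar n).natDegree = n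
  leadingCoeff_eq : ∀ n, (φbar n).leadingCoeff = (φ n).leadingCoeff
  orthonormal : ∀ k n, circleMean
    (fun ζ => w ζ * (φ k).eval ζ * (φbar n).eval ((starRingEnd ℂ) ζ)) = if k = n then 1 else 0

/-- The reciprocal polynomial `φ*ₙ(x) = xⁿ φbarₙ(1/x)`. -/
def recip (φbar : ℕ → Polynomial ℂ) (n : ℕ) : Polynomial ℂ := (φbar n).reflect n

/-- The Carathéodory function `F` of the weight. -/
def caratheodory (w : ℂ → ℂ) (x : ℂ) : ℂ := circleMean (fun ζ => (ζ + x) / (ζ - x) * w ζ)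

/-- The polynomial of the second kind `ψₙ`, with `ψ₀ = 1/κ₀`. -/
def psi (w : ℂ → ℂ) (φ : ℕ → Polynomial ℂ) (n : ℕ) (x : ℂ) : ℂ :=
  if n = 0 then 1 / (φ 0).leadingCoeff
  else circleMean (fun ζ => (ζ + x) / (ζ - x) * w ζ * ((φ n).eval ζ - (φ n).eval x))

/-- The reciprocal polynomial of the second kind `ψ*ₙ`, with `ψ*₀ = 1/κ₀`. -/
def psiStar (w : ℂ → ℂ) (φbar : ℕ → Polynomial ℂ) (n : ℕ) (x : ℂ) : ℂ :=
  if n = 0 then 1 / (φbar 0).leadingCoeff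
  else -circleMean (fun ζ => (ζ + x) / (ζ - x) * w ζ *
    (x ^ n * (φbar n).eval ((starRingEnd ℂ) ζ) - (recip φbar n).eval x))

/-- The associated function `εₙ = ψₙ + F φₙ`. -/
def eps (w : ℂ → ℂ) (φ : ℕ → Polynomial ℂ) (n : ℕ) (x : ℂ) : ℂ :=
  psi w φ n x + caratheodory w x * (φ n).eval x

/-- The reciprocal associated function `ε*ₙ = ψ*ₙ - F φ*ₙ`. -/
def epsStar (w : ℂ → ℂ) (φbar : ℕ → Polynomial ℂ) (n : ℕ) (x : ℂ) : ℂ :=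
  psiStar w φbar n x - caratheodory w x * (recip φbar n).eval x

end BiorthUnitCircle

end

open BiorthUnitCircle

/-! Write B(p, q) for the circle mean of w(ζ) p(ζ) q(1/ζ), and σ_j for ρ_j ż_j / z_j. Off the
singularities ẇ = -w ∑ σ_j z_j / (ζ - z_j), so Ḃ is a combination of the pairings D_j with weight w
/ (ζ - z_j) (`hasDerivAt_pairing`). Differentiating B(φ_n, q) with q frozen gives the coordinates of
the derivative of φ_n in the basis φ_k, k ≤ n. Division with remainder by ζ - z_j shows that
D_j(φ_n, φbar_k) is, up to a term for k = n, a multiple of ε_n(z_j) times the value at z_j of the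
reflected φbar_k (`cauchy_right_left`). The sum over k is a Christoffel-Darboux kernel, whose closed
form produces the factors x / (x - z_j) and 1 / (x - z_j). The other slot of B treats φ*_n in the
same way.

The associated functions are Cauchy transforms: ε_n(x) = 2 D_x(X φ_n, 1) and ε*_n(x) = 2/κ_n - 2
D_x(X φ*_n, 1). Their derivatives combine those of the polynomials with that of D_x, which partial
fractions reduce to D_x and the D_j. The Cauchy transform of the kernel (`cauchy_kernel`) and the
Casoratian identity collapse the outcome (`assoc_deriv`, `assocStar_deriv`). This algebra uses only
bilinearity, the Toeplitz property and D((X - a) p, q) = B(p, q), so it is carried out for abstract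
forms.

Two analytic inputs remain. The coefficients are differentiable by Cramer's rule for the Gram
matrix, and κ_n because κ_n² is and κ_n is continuous. Differentiation under the integral rests on
`exists_difference_bound`: a singularity moving along the circle makes ẇ blow up at a different
point at each time, so the difference quotient is dominated instead. -/

namespace BiorthUnitCircle

open Polynomial Metric MeasureTheory

/-! ### Bi-orthogonality for an abstract bilinear form. -/

/-- Two sequences of polynomials, with degrees and leading coefficients as in a bi-orthonormal
system, that are bi-orthonormal for an abstract bilinear form. -/
structure IsBiorthogonal (B : ℂ[X] →ₗ[ℂ] ℂ[X] →ₗ[ℂ] ℂ) (p q : ℕ → ℂ[X]) : Prop where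
  natDegree_left : ∀ n, (p n).natDegree = n
  natDegree_right : ∀ n, (q n).natDegree = n
  leadingCoeff_eq : ∀ n, (q n).leadingCoeff = (p n).leadingCoeff
  orthonormal : ∀ k n, B (p k) (q n) = if k = n then 1 else 0

namespace IsBiorthogonal

variable {B : ℂ[X] →ₗ[ℂ] ℂ[X] →ₗ[ℂ] ℂ} {p q : ℕ → ℂ[X]}

theorem flip (h : IsBiorthogonal B p q) : IsBiorthogonal B.flip q p where
  natDegree_left := h.natDegree_right
  natDegree_right := h.natDegree_left
  leadingCoeff_eq n := (h.leadingCoeff_eq n).symm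
  orthonormal k n := by
    rw [LinearMap.flip_apply, h.orthonormal]
    simp only [eq_comm]

theorem leadingCoeff_ne_zero (h : IsBiorthogonal B p q) (n : ℕ) : (p n).leadingCoeff ≠ 0 := by
  intro h0
  have := h.orthonormal n n
  rw [leadingCoeff_eq_zero.1 h0] at this
  simp at this

theorem coeff_left (h : IsBiorthogonal B p q) (n : ℕ) : (p n).coeff n = (p n).leadingCoeff := by
  rw [leadingCoeff, h.natDegree_left]

theorem coeff_right (h : IsBiorthogonal B p q) (n : ℕ) : (q n).coeff n = (p n).leadingCoeff := by
  rw [← h.leadingCoeff_eq, leadingCoeff, h.natDegree_right]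

theorem degree_sub_lt (h : IsBiorthogonal B p q) {r : ℂ[X]} {d : ℕ} (hr : r.natDegree ≤ d) :
    (r - C (r.coeff d / (p d).leadingCoeff) * p d).degree < d := by
  rw [degree_lt_iff_coeff_zero]
  intro m hm
  rcases hm.eq_or_lt with rfl | hm
  · rw [coeff_sub, coeff_C_mul, h.coeff_left, div_mul_cancel₀ _ (h.leadingCoeff_ne_zero _), sub_self]
  · rw [coeff_sub, coeff_C_mul, coeff_eq_zero_of_natDegree_lt (hr.trans_lt hm),
      coeff_eq_zero_of_natDegree_lt (p := p d) (by rwa [h.natDegree_left]), mul_zero, sub_zero]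

/-- The bound `d` is kept apart from `n` so that the induction can strip off multiples of `p d`
while `q n` stays fixed. -/
theorem right_eq_zero (h : IsBiorthogonal B p q) {n d : ℕ} (hd : d ≤ n) {r : ℂ[X]}
    (hr : r.degree < d) : B r (q n) = 0 := by
  induction d generalizing r with
  | zero =>
    rw [show r = 0 by simpa using hr]
    simp
  | succ d ih =>
    have hr' : r.natDegree ≤ d := natDegree_le_iff_degree_le.2 (Order.lt_succ_iff.1 hr)
    have := ih (by omega) (h.degree_sub_lt hr')
    rw [map_sub, LinearMap.sub_apply, sub_eq_zero] at this
    rw [this, ← smul_eq_C_mul, map_smul, LinearMap.smul_apply, h.orthonormal, if_neg (by omega),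
      smul_zero]

theorem right_eq (h : IsBiorthogonal B p q) {n : ℕ} {r : ℂ[X]} (hr : r.natDegree ≤ n) :
    B r (q n) = r.coeff n / (p n).leadingCoeff := by
  have := h.right_eq_zero le_rfl (h.degree_sub_lt hr)
  rw [map_sub, LinearMap.sub_apply, sub_eq_zero] at this
  rw [this, ← smul_eq_C_mul, map_smul, LinearMap.smul_apply, h.orthonormal, if_pos rfl, smul_eq_mul,
    mul_one]

theorem left_eq (h : IsBiorthogonal B p q) {n : ℕ} {r : ℂ[X]} (hr : r.natDegree ≤ n) :
    B (p n) r = r.coeff n / (p n).leadingCoeff := by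
  rw [← LinearMap.flip_apply, h.flip.right_eq hr, h.leadingCoeff_eq]

theorem left_eq_zero (h : IsBiorthogonal B p q) {n : ℕ} {r : ℂ[X]} (hr : r.degree < n) :
    B (p n) r = 0 := by
  rw [← LinearMap.flip_apply, h.flip.right_eq_zero le_rfl hr]

/-- A nonzero `r` of degree `k` would pair with `q k` to its leading coefficient divided by that of
`p k`, which is nonzero. -/
theorem eq_zero_of_forall_right (h : IsBiorthogonal B p q) {n : ℕ} {r : ℂ[X]} (hr : r.degree < n)
    (h0 : ∀ k < n, B r (q k) = 0) : r = 0 := by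
  by_contra hne
  have hlt : r.natDegree < n := (natDegree_lt_iff_degree_lt hne).2 hr
  have := h0 _ hlt
  rw [h.right_eq le_rfl, div_eq_zero_iff] at this
  exact this.elim (fun h1 => hne (leadingCoeff_eq_zero.1 h1)) (h.leadingCoeff_ne_zero _)

theorem eq_zero_of_forall_X_pow (h : IsBiorthogonal B p q) {n : ℕ} {r : ℂ[X]} (hr : r.degree < n)
    (h0 : ∀ k < n, B r (X ^ k) = 0) : r = 0 := by
  refine h.eq_zero_of_forall_right hr fun k hk => ?_
  rw [(q k).as_sum_range_C_mul_X_pow, map_sum]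
  refine Finset.sum_eq_zero fun i hi => ?_
  rw [Finset.mem_range, h.natDegree_right] at hi
  rw [← smul_eq_C_mul, map_smul, h0 i (by omega), smul_zero]

theorem eq_sum (h : IsBiorthogonal B p q) {n : ℕ} {r : ℂ[X]} (hr : r.natDegree ≤ n) :
    r = ∑ k ∈ Finset.range (n + 1), C (B r (q k)) * p k := by
  rw [← sub_eq_zero]
  refine h.eq_zero_of_forall_right (n := n + 1) ?_ fun k hk => ?_
  · refine Order.lt_succ_iff.2 (natDegree_le_iff_degree_le.1 ?_)
    refine (natDegree_sub_le _ _).trans (max_le hr (natDegree_sum_le_of_forall_le _ _ fun i hi => ?_))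
    refine (natDegree_C_mul_le _ _).trans ?_
    rw [h.natDegree_left]
    exact Finset.mem_range_succ_iff.1 hi
  · rw [map_sub, LinearMap.sub_apply, map_sum, LinearMap.sum_apply]
    simp only [← smul_eq_C_mul, map_smul, LinearMap.smul_apply, h.orthonormal, smul_eq_mul,
      mul_ite, mul_one, mul_zero, Finset.sum_ite_eq', Finset.mem_range, if_pos hk, sub_self]

end IsBiorthogonal

/-! ### Toeplitz forms and their Cauchy transforms. -/

/-- A bilinear form on polynomials is Toeplitz if `B (X ^ i) (X ^ j)` depends only on `i - j`. -/
def IsToeplitz (B : ℂ[X] →ₗ[ℂ] ℂ[X] →ₗ[ℂ] ℂ) : Prop :=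
  ∀ p q, B (X * p) (X * q) = B p q

theorem apply_C_mul (B : ℂ[X] →ₗ[ℂ] ℂ[X] →ₗ[ℂ] ℂ) (c : ℂ) (r s : ℂ[X]) :
    B (C c * r) s = c * B r s := by
  rw [← smul_eq_C_mul, map_smul, LinearMap.smul_apply, smul_eq_mul]

theorem IsToeplitz.X_pow_mul {B : ℂ[X] →ₗ[ℂ] ℂ[X] →ₗ[ℂ] ℂ} (hB : IsToeplitz B) (i : ℕ)
    (p q : ℂ[X]) : B (X ^ i * p) (X ^ i * q) = B p q := by
  induction i with
  | zero => simp
  | succ i ih => rw [pow_succ', mul_assoc, mul_assoc, hB, ih]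

/-- For a monomial `X ^ i` this is the shift of both slots of `B p (X ^ (n - i))` by `X ^ i`. Since
the product on the right is commutative, applying it twice exchanges the two factors. -/
theorem IsToeplitz.reflect_right {B : ℂ[X] →ₗ[ℂ] ℂ[X] →ₗ[ℂ] ℂ} (hB : IsToeplitz B) {n : ℕ}
    (p : ℂ[X]) {q : ℂ[X]} (hq : q.natDegree ≤ n) : B p (q.reflect n) = B (q * p) (X ^ n) := by
  rw [q.as_sum_range_C_mul_X_pow' (Nat.lt_succ_of_le hq)]
  have : ∀ s : Finset ℕ, reflect n (∑ i ∈ s, C (q.coeff i) * X ^ i)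
      = ∑ i ∈ s, reflect n (C (q.coeff i) * X ^ i) := by
    intro s
    induction s using Finset.induction_on with
    | empty => simp
    | insert a s ha ih => rw [Finset.sum_insert ha, Finset.sum_insert ha, reflect_add, ih]
  rw [this, map_sum, Finset.sum_mul, map_sum, LinearMap.sum_apply]
  refine Finset.sum_congr rfl fun i hi => ?_
  have hi' : i ≤ n := Finset.mem_range_succ_iff.1 hi
  rw [reflect_C_mul_X_pow, revAt_le hi', mul_assoc, ← smul_eq_C_mul, ← smul_eq_C_mul, map_smul,
    map_smul, LinearMap.smul_apply, ← hB.X_pow_mul i p, ← pow_add, Nat.add_sub_cancel' hi']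

/-- `D` is the bilinear form of the weight of `B` divided by `ζ - a`. -/
structure IsCauchyTransform (B : ℂ[X] →ₗ[ℂ] ℂ[X] →ₗ[ℂ] ℂ) (a : ℂ)
    (D : ℂ[X] →ₗ[ℂ] ℂ[X] →ₗ[ℂ] ℂ) : Prop where
  toeplitz : IsToeplitz D
  sub_mul : ∀ p q, D ((X - C a) * p) q = B p q

namespace IsCauchyTransform

variable {B D : ℂ[X] →ₗ[ℂ] ℂ[X] →ₗ[ℂ] ℂ} {a : ℂ}

theorem base_toeplitz (hD : IsCauchyTransform B a D) : IsToeplitz B := fun p q => by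
  rw [← hD.sub_mul, ← hD.sub_mul, mul_left_comm, hD.toeplitz]

theorem X_mul (hD : IsCauchyTransform B a D) (p q : ℂ[X]) :
    D (X * p) q = a * D p q + B p q := by
  rw [← hD.sub_mul, _root_.sub_mul, map_sub, LinearMap.sub_apply, ← smul_eq_C_mul, map_smul,
    LinearMap.smul_apply, smul_eq_mul]
  ring

end IsCauchyTransform

theorem X_sub_C_mul_divByMonic_add (a : ℂ) (r : ℂ[X]) :
    (X - C a) * (r /ₘ (X - C a)) + C (r.eval a) = r := by
  rw [X_sub_C_mul_divByMonic_eq_sub_modByMonic, modByMonic_X_sub_C_eq_C_eval, sub_add_cancel]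

theorem natDegree_divByMonic_X_sub_C_le {a : ℂ} {r : ℂ[X]} {n : ℕ} (hr : r.natDegree ≤ n + 1) :
    (r /ₘ (X - C a)).natDegree ≤ n := by
  rw [natDegree_divByMonic _ (monic_X_sub_C a), natDegree_X_sub_C]
  omega

theorem natDegree_reflect_le_of_le {r : ℂ[X]} {n : ℕ} (hr : r.natDegree ≤ n) :
    (r.reflect n).natDegree ≤ n := by
  rw [natDegree_le_iff_coeff_eq_zero]
  intro m hm
  rw [coeff_reflect, revAt_eq_self_of_lt hm]
  exact coeff_eq_zero_of_natDegree_lt (hr.trans_lt hm)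

/-! ### The Christoffel-Darboux kernel and the associated functions. -/

namespace IsBiorthogonal

variable {B D D' : ℂ[X] →ₗ[ℂ] ℂ[X] →ₗ[ℂ] ℂ} {p q : ℕ → ℂ[X]} {a x : ℂ}

/-- The Christoffel-Darboux kernel `∑ k ≤ n, aⁿ qₖ(1/a) pₖ(X)`. -/
noncomputable def kernel (p q : ℕ → ℂ[X]) (n : ℕ) (a : ℂ) : ℂ[X] :=
  ∑ k ∈ Finset.range (n + 1), C (((q k).reflect n).eval a) * p k

theorem natDegree_kernel_le (h : IsBiorthogonal B p q) (n : ℕ) (a : ℂ) :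
    (kernel p q n a).natDegree ≤ n := by
  refine natDegree_sum_le_of_forall_le _ _ fun i hi => (natDegree_C_mul_le _ _).trans ?_
  rw [h.natDegree_left]
  exact Finset.mem_range_succ_iff.1 hi

theorem kernel_reproducing (h : IsBiorthogonal B p q) {n : ℕ} (a : ℂ) {r : ℂ[X]}
    (hr : r.natDegree ≤ n) : B (kernel p q n a) r = (r.reflect n).eval a := by
  have hsum : r.reflect n = ∑ k ∈ Finset.range (n + 1), C (B (p k) r) * (q k).reflect n := by
    ext i
    rw [coeff_reflect]
    conv_lhs => rw [h.flip.eq_sum hr]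
    simp only [finsetSum_coeff, coeff_C_mul, coeff_reflect, LinearMap.flip_apply]
  rw [hsum, eval_finsetSum, kernel, map_sum, LinearMap.sum_apply]
  refine Finset.sum_congr rfl fun k _ => ?_
  rw [← smul_eq_C_mul, map_smul, LinearMap.smul_apply, eval_mul, eval_C, smul_eq_mul, mul_comm]

theorem reflect_left_eq (h : IsBiorthogonal B p q) (hB : IsToeplitz B) {n : ℕ} {r : ℂ[X]}
    (hr : r.natDegree ≤ n) : B ((q n).reflect n) r = r.coeff 0 / (p n).leadingCoeff := by
  rw [← reflect_reflect (N := n) (p := r), hB.reflect_right _ (natDegree_reflect_le_of_le hr), mul_comm,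
    ← hB.reflect_right _ (natDegree_reflect_le_of_le (h.natDegree_right n).le), reflect_reflect,
    h.right_eq (natDegree_reflect_le_of_le hr), reflect_reflect, coeff_reflect, revAt_le le_rfl,
    Nat.sub_self]

/-- Pair `p n` with the reflected kernel: orthogonality reads off the constant term of the kernel,
while moving the reflection onto `p n` lets the reproducing property evaluate it at `a`. -/
theorem kernel_coeff_zero (h : IsBiorthogonal B p q) (hB : IsToeplitz B) (n : ℕ) (a : ℂ) :
    (kernel p q n a).coeff 0 = (p n).leadingCoeff * (p n).eval a := by
  have hk := natDegree_reflect_le_of_le (h.natDegree_kernel_le n a)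
  have h1 : B (p n) ((kernel p q n a).reflect n) = (p n).eval a := by
    rw [hB.reflect_right _ (h.natDegree_kernel_le n a), mul_comm,
      ← hB.reflect_right _ (h.natDegree_left n).le,
      h.kernel_reproducing a (natDegree_reflect_le_of_le (h.natDegree_left n).le), reflect_reflect]
  rw [h.left_eq hk, coeff_reflect, revAt_le le_rfl, Nat.sub_self,
    div_eq_iff (h.leadingCoeff_ne_zero n)] at h1
  rw [h1, mul_comm]

theorem kernel_coeff_self (h : IsBiorthogonal B p q) (n : ℕ) (a : ℂ) :
    (kernel p q n a).coeff n = (p n).leadingCoeff * ((q n).reflect n).eval a := by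
  rw [kernel, finsetSum_coeff, Finset.sum_eq_single n, coeff_C_mul, h.coeff_left, mul_comm]
  · intro k hk hkn
    have hk' := Finset.mem_range_succ_iff.1 hk
    rw [coeff_C_mul, coeff_eq_zero_of_natDegree_lt (by rw [h.natDegree_left]; omega), mul_zero]
  · intro hn
    exact absurd (Finset.self_mem_range_succ n) hn

/-- The Christoffel-Darboux formula. -/
theorem christoffel_darboux (h : IsBiorthogonal B p q) (hB : IsToeplitz B) (n : ℕ) (a : ℂ) :
    (X - C a) * kernel p q n a = C (((q n).reflect n).eval a) * (X * p n)
      - C (a * (p n).eval a) * (q n).reflect n := by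
  rw [← sub_eq_zero]
  -- The difference `N` has no constant term and no terms of degree above `n`, so `N = X * S` with
  -- `S` of degree below `n`. By the Toeplitz shift, `B S (X ^ l) = B N (X ^ (l + 1))`; this
  -- vanishes for `l < n`, which forces `S = 0`.
  set N := (X - C a) * kernel p q n a - (C (((q n).reflect n).eval a) * (X * p n)
      - C (a * (p n).eval a) * (q n).reflect n) with hN
  have hk := h.natDegree_kernel_le n a
  have hs := natDegree_reflect_le_of_le (h.natDegree_right n).le
  have h0 : N.coeff 0 = 0 := by
    have : ((q n).reflect n).coeff 0 = (p n).leadingCoeff := by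
      rw [coeff_reflect, revAt_le (Nat.zero_le n), Nat.sub_zero, h.coeff_right]
    simp only [hN, coeff_sub, mul_coeff_zero, coeff_X_zero, coeff_C_zero,
      h.kernel_coeff_zero hB, this]
    ring
  obtain ⟨S, hS⟩ := X_dvd_iff.2 h0
  have hcoeff : ∀ m, n ≤ m → S.coeff m = 0 := by
    intro m hm
    rw [← coeff_X_mul, ← hS]
    simp only [hN, coeff_sub, coeff_C_mul, sub_mul, coeff_X_mul]
    rw [coeff_eq_zero_of_natDegree_lt (hk.trans_lt (Nat.lt_succ_of_le hm)),
      coeff_eq_zero_of_natDegree_lt (hs.trans_lt (Nat.lt_succ_of_le hm))]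
    rcases hm.eq_or_lt with rfl | hm
    · rw [h.kernel_coeff_self, h.coeff_left]
      ring
    · rw [coeff_eq_zero_of_natDegree_lt (hk.trans_lt hm),
        coeff_eq_zero_of_natDegree_lt (by rwa [h.natDegree_left])]
      ring
  have hS0 : S = 0 := by
    refine h.eq_zero_of_forall_X_pow ((degree_lt_iff_coeff_zero _ _).2 hcoeff) fun l hl => ?_
    have e1 : B (kernel p q n a) (X ^ l) = a ^ (n - l) := by
      rw [h.kernel_reproducing a (by rw [natDegree_X_pow]; omega), reflect_monomial,
        revAt_le hl.le, eval_pow, eval_X]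
    have e2 : B (kernel p q n a) (X ^ (l + 1)) = a ^ (n - (l + 1)) := by
      rw [h.kernel_reproducing a (by rw [natDegree_X_pow]; omega), reflect_monomial,
        revAt_le hl, eval_pow, eval_X]
    have e3 : B (p n) (X ^ l) = 0 := h.left_eq_zero (by rw [degree_X_pow]; exact_mod_cast hl)
    have e4 : B ((q n).reflect n) (X ^ (l + 1)) = 0 := by
      rw [h.reflect_left_eq hB (by rw [natDegree_X_pow]; omega), coeff_X_pow,
        if_neg (by omega), zero_div]
    rw [← hB, ← hS, ← pow_succ', hN]
    simp only [sub_mul, map_sub, LinearMap.sub_apply, ← smul_eq_C_mul, map_smul,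
      LinearMap.smul_apply, smul_eq_mul, e2, e4]
    rw [pow_succ' X l, hB, hB, e1, e3, show n - l = n - (l + 1) + 1 by omega, pow_succ']
    ring
  rw [hS, hS0, mul_zero]

/-- Exchanging `a` and `x` changes the sign of the right side of the Christoffel-Darboux formula,
and of the factor `x - a`. -/
theorem kernel_symm (h : IsBiorthogonal B p q) (hB : IsToeplitz B) (n : ℕ) {a x : ℂ} :
    (kernel p q n a).eval x = (kernel p q n x).eval a := by
  rcases eq_or_ne x a with rfl | hx
  · rfl
  have h1 := congrArg (eval x) (h.christoffel_darboux hB n a)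
  have h2 := congrArg (eval a) (h.christoffel_darboux hB n x)
  simp only [eval_mul, eval_sub, eval_X, eval_C] at h1 h2
  refine mul_left_cancel₀ (sub_ne_zero.2 hx) ?_
  linear_combination h1 + h2

/-- Division with remainder under the Cauchy transform. -/
theorem cauchy_right_eq (h : IsBiorthogonal B p q) (hD : IsCauchyTransform B a D) {n : ℕ}
    {r : ℂ[X]} (hr : r.natDegree ≤ n + 1) :
    D r (q n) = r.eval a * D 1 (q n) + r.coeff (n + 1) / (p n).leadingCoeff := by
  have hu := natDegree_divByMonic_X_sub_C_le (a := a) hr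
  have hdiv := X_sub_C_mul_divByMonic_add a r
  set u := r /ₘ (X - C a)
  have hc : r.coeff (n + 1) = u.coeff n := by
    rw [← hdiv, coeff_add, sub_mul, coeff_sub, coeff_X_mul, coeff_C_mul, coeff_C_of_ne_zero (by omega),
      coeff_eq_zero_of_natDegree_lt (Nat.lt_succ_of_le hu)]
    ring
  rw [hc, ← h.right_eq hu, ← hD.sub_mul, ← apply_C_mul, mul_one, add_comm, ← LinearMap.add_apply,
    ← map_add, hdiv]

/-- The associated function, in terms of the Cauchy transform `D` of the pairing. -/
noncomputable def assoc (D : ℂ[X] →ₗ[ℂ] ℂ[X] →ₗ[ℂ] ℂ) (p : ℕ → ℂ[X]) (n : ℕ) : ℂ :=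
  2 * D (X * p n) 1

/-- The reciprocal associated function, in terms of the Cauchy transform of the pairing. -/
noncomputable def assocStar (D : ℂ[X] →ₗ[ℂ] ℂ[X] →ₗ[ℂ] ℂ) (p q : ℕ → ℂ[X]) (n : ℕ) : ℂ :=
  2 / (p n).leadingCoeff - 2 * D (X * (q n).reflect n) 1

/-- The Toeplitz shift turns `D (X * q*) 1` into `D (X ^ (n + 1)) (q n)`. Dividing `X ^ (n + 1)` by
`X - a` then leaves the quotient term `1 / κ`, which the `2 / κ` in the definition cancels. -/
theorem assocStar_eq (h : IsBiorthogonal B p q) (hD : IsCauchyTransform B a D) (n : ℕ) :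
    assocStar D p q n = -(2 * a ^ (n + 1) * D 1 (q n)) := by
  have h1 : D (X * (q n).reflect n) 1 = D (X ^ (n + 1)) (q n) := by
    have := hD.toeplitz.reflect_right (n := n) (X ^ (n + 1))
      (natDegree_reflect_le_of_le (h.natDegree_right n).le)
    rw [reflect_reflect] at this
    rw [this, ← hD.toeplitz.X_pow_mul n, mul_one]
    ring_nf
  rw [assocStar, h1, h.cauchy_right_eq hD (by rw [natDegree_X_pow]), eval_pow, eval_X, coeff_X_pow,
    if_pos rfl]
  ring

theorem cauchy_left_right (h : IsBiorthogonal B p q) (hD : IsCauchyTransform B a D) {k n : ℕ}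
    (hk : k ≤ n) :
    2 * a ^ (n + 1) * D (p k) (q n) = -((p k).eval a * assocStar D p q n) := by
  rw [h.cauchy_right_eq hD (by rw [h.natDegree_left]; omega), h.assocStar_eq hD,
    coeff_eq_zero_of_natDegree_lt (by rw [h.natDegree_left]; omega)]
  ring

theorem cauchy_right_left (h : IsBiorthogonal B p q) (hD : IsCauchyTransform B a D) (ha : a ≠ 0)
    {k n : ℕ} (hk : k ≤ n) :
    2 * a ^ (n + 1) * D (p n) (q k) = ((q k).reflect n).eval a * assoc D p n
      - if k = n then 2 * a ^ n else 0 := by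
  have hqk : (q k).natDegree ≤ n := by rwa [h.natDegree_right]
  have hr := natDegree_reflect_le_of_le hqk
  have hr0 : ((q k).reflect n).coeff 0 = if k = n then (p n).leadingCoeff else 0 := by
    rw [coeff_reflect, revAt_le (Nat.zero_le n), Nat.sub_zero]
    split_ifs with hkn
    · rw [hkn, h.coeff_right]
    · exact coeff_eq_zero_of_natDegree_lt (by rw [h.natDegree_right]; omega)
  have hqr : q k = ((q k).reflect n).reflect n := by rw [reflect_reflect]
  set r := (q k).reflect n
  -- This combination vanishes at `a`, so it is `(X - a) * u`. Pairing it, times `p n`, with `X ^ n`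
  -- under `D` gives `D (p n) (q k)` and the associated function from its two terms; under `B` only
  -- the constant term of `u` survives.
  set g := C (a ^ (n + 1)) * r - C (r.eval a) * X ^ (n + 1) with hg
  have hgd : g.natDegree ≤ n + 1 := by
    refine (natDegree_sub_le _ _).trans (max_le ?_ ?_)
    · exact (natDegree_C_mul_le _ _).trans (hr.trans (Nat.le_succ n))
    · exact (natDegree_C_mul_X_pow_le _ _)
  have hu := natDegree_divByMonic_X_sub_C_le (a := a) hgd
  have hdiv := X_sub_C_mul_divByMonic_add a g
  have hg0 : g.eval a = 0 := by simp [hg]; ring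
  rw [hg0, C_0, add_zero] at hdiv
  set u := g /ₘ (X - C a)
  have hu0 : a * u.coeff 0 = -(a ^ (n + 1) * r.coeff 0) := by
    have := congrArg (fun s => s.coeff 0) hdiv
    simp only [hg, mul_coeff_zero, coeff_sub, coeff_X_zero, coeff_C_zero, coeff_X_pow] at this
    rw [if_neg (by omega)] at this
    linear_combination -this
  have h1 : D (g * p n) (X ^ n) = u.coeff 0 / (p n).leadingCoeff := by
    rw [← hdiv, mul_assoc, hD.sub_mul, ← hD.base_toeplitz.reflect_right _ hu,
      h.left_eq (natDegree_reflect_le_of_le hu), coeff_reflect, revAt_le le_rfl, Nat.sub_self]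
  have h2 : D (X ^ (n + 1) * p n) (X ^ n) = D (X * p n) 1 := by
    rw [← hD.toeplitz.X_pow_mul n (X * p n), mul_one, pow_succ, mul_assoc]
  have h3 : D (p n) (q k) = D (r * p n) (X ^ n) := by
    rw [hqr, hD.toeplitz.reflect_right _ hr]
  rw [hg, sub_mul, map_sub, LinearMap.sub_apply, mul_assoc, mul_assoc, apply_C_mul,
    apply_C_mul, h2, ← h3] at h1
  have hc := h.leadingCoeff_ne_zero n
  refine mul_left_cancel₀ (mul_ne_zero ha hc) ?_
  rw [assoc]
  rw [eq_div_iff hc] at h1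
  have h4 : (p n).leadingCoeff * (if k = n then 2 * a ^ n else 0) = 2 * a ^ n * r.coeff 0 := by
    rw [hr0]; split_ifs <;> ring
  linear_combination 2 * a * h1 + 2 * hu0 + a * h4

/-- The Casoratian of the two solutions of the recurrence. -/
theorem casoratian (h : IsBiorthogonal B p q) (hD : IsCauchyTransform B a D) (n : ℕ) :
    (p n).eval a * assocStar D p q n + ((q n).reflect n).eval a * assoc D p n = 2 * a ^ n := by
  have hB := hD.base_toeplitz
  -- The right side of the Casoratian is half accounted for here: `B` of the kernel equals `D` of `X
  -- - a` times the kernel, which Christoffel-Darboux expands.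
  have h1 : B (kernel p q n a) 1 = a ^ n := by
    rw [h.kernel_reproducing a (by simp), ← C_1, reflect_C]
    simp
  have h2 : B ((q n).reflect n) 1 = 1 / (p n).leadingCoeff := by
    rw [h.reflect_left_eq hB (by simp), coeff_one_zero]
  have h3 := hD.X_mul ((q n).reflect n) 1
  rw [← hD.sub_mul, h.christoffel_darboux hB] at h1
  rw [map_sub, LinearMap.sub_apply, apply_C_mul, apply_C_mul] at h1
  rw [assoc, assocStar]
  rw [h2] at h3
  linear_combination 2 * h1 - 2 * (p n).eval a * h3

/-- Apply both `D` and `D'` to `X * (X - a) * K`, with `K` the kernel. The unknown `B (X * K) 1`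
occurs in both and cancels in the difference, and Christoffel-Darboux expresses the rest through the
associated functions. -/
theorem cauchy_kernel (h : IsBiorthogonal B p q) (hD : IsCauchyTransform B a D)
    (hD' : IsCauchyTransform B x D') (n : ℕ) :
    (x - a) * (2 * D' (X * kernel p q n a) 1) =
      a * (p n).eval a * (assocStar D' p q n - assocStar D p q n)
      + ((q n).reflect n).eval a * (x * assoc D' p n - a * assoc D p n) := by
  have hB := hD.base_toeplitz
  have hcd := h.christoffel_darboux hB n a
  have e1 : D (X * ((X - C a) * kernel p q n a)) 1 = B (X * kernel p q n a) 1 := by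
    rw [mul_left_comm, hD.sub_mul]
  have e2 : D' (X * ((X - C a) * kernel p q n a)) 1
      = (x - a) * D' (X * kernel p q n a) 1 + B (X * kernel p q n a) 1 := by
    rw [← hD'.sub_mul, ← apply_C_mul, ← LinearMap.add_apply, ← map_add, C_sub]
    congr 2
    ring
  have e3 := hD.X_mul (X * p n) 1
  have e4 := hD'.X_mul (X * p n) 1
  rw [hcd, mul_sub, mul_left_comm, mul_left_comm X (C _), map_sub, LinearMap.sub_apply,
    apply_C_mul, apply_C_mul] at e1 e2
  simp only [assoc, assocStar]
  linear_combination 2 * e1 - 2 * e2 + 2 * ((q n).reflect n).eval a * (e4 - e3)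

end IsBiorthogonal

/-! ### Circle means and the pairing defined by a weight. -/

theorem eventuallyEq_codiscreteWithin_of_finite {f g : ℂ → ℂ} {S : Set ℂ} (hS : S.Finite)
    (h : ∀ ζ, ‖ζ‖ = 1 → ζ ∉ S → f ζ = g ζ) :
    f =ᶠ[codiscreteWithin (sphere (0 : ℂ) |1|)] g := by
  have : Sᶜ ∈ codiscreteWithin (sphere (0 : ℂ) |1|) := by
    rw [mem_codiscreteWithin]
    intro x _
    rw [disjoint_principal_right]
    refine mem_nhdsWithin.2 ⟨(S \ {x})ᶜ, (hS.subset Set.sdiff_subset).isClosed.isOpen_compl,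
      by simp, ?_⟩
    rintro y ⟨hy, hyx⟩ ⟨_, hyS⟩
    exact hy ⟨not_not.1 hyS, hyx⟩
  filter_upwards [this, self_mem_codiscreteWithin (sphere (0 : ℂ) |1|)] with ζ h1 h2
  exact h ζ (by simpa using h2) h1

theorem circleMean_congr_of_finite {f g : ℂ → ℂ} {S : Set ℂ} (hS : S.Finite)
    (h : ∀ ζ, ‖ζ‖ = 1 → ζ ∉ S → f ζ = g ζ) : circleMean f = circleMean g :=
  Real.circleAverage_congr_codiscreteWithin (eventuallyEq_codiscreteWithin_of_finite hS h)
    one_ne_zero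

theorem circleMean_congr {f g : ℂ → ℂ} (h : ∀ ζ, ‖ζ‖ = 1 → f ζ = g ζ) :
    circleMean f = circleMean g :=
  circleMean_congr_of_finite Set.finite_empty fun ζ hζ _ => h ζ hζ

theorem circleMean_add {f g : ℂ → ℂ} (hf : CircleIntegrable f 0 1) (hg : CircleIntegrable g 0 1) :
    circleMean (fun ζ => f ζ + g ζ) = circleMean f + circleMean g :=
  Real.circleAverage_fun_add hf hg

theorem circleMean_const_mul (c : ℂ) (f : ℂ → ℂ) :
    circleMean (fun ζ => c * f ζ) = c * circleMean f :=
  Real.circleAverage_fun_smul (a := c) (f := f)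

theorem circleMean_sum {ι : Type*} {s : Finset ι} {f : ι → ℂ → ℂ}
    (h : ∀ i ∈ s, CircleIntegrable (f i) 0 1) :
    circleMean (fun ζ => ∑ i ∈ s, f i ζ) = ∑ i ∈ s, circleMean (f i) :=
  Real.circleAverage_fun_sum h

theorem continuous_eval_conj (q : ℂ[X]) : Continuous fun ζ : ℂ => q.eval ((starRingEnd ℂ) ζ) :=
  q.continuous.comp Complex.continuous_conj

theorem circleIntegrable_mul_mul {V : ℂ → ℂ} (hV : CircleIntegrable V 0 1) (p q : ℂ[X]) :
    CircleIntegrable (fun ζ => V ζ * p.eval ζ * q.eval ((starRingEnd ℂ) ζ)) 0 1 :=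
  (hV.fun_mul_continuousOn p.continuous.continuousOn).fun_mul_continuousOn
    (continuous_eval_conj q).continuousOn

open scoped Classical in
/-- The bilinear form `∫ V(ζ) p(ζ) q(1/ζ)` of an integrable weight `V` on the unit circle. -/
noncomputable def pairing (V : ℂ → ℂ) : ℂ[X] →ₗ[ℂ] ℂ[X] →ₗ[ℂ] ℂ :=
  -- Integrability is what makes the mean additive; the value `0` otherwise only makes the form
  -- total.
  if hV : CircleIntegrable V 0 1 then
    LinearMap.mk₂ ℂ
      (fun p q => circleMean fun ζ => V ζ * p.eval ζ * q.eval ((starRingEnd ℂ) ζ))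
      (fun p p' q => by
        rw [← circleMean_add (circleIntegrable_mul_mul hV p q) (circleIntegrable_mul_mul hV p' q)]
        simp only [eval_add, mul_add, add_mul])
      (fun c p q => by
        rw [smul_eq_mul, ← circleMean_const_mul]
        simp only [eval_smul, smul_eq_mul, mul_left_comm _ c, mul_assoc])
      (fun p q q' => by
        rw [← circleMean_add (circleIntegrable_mul_mul hV p q) (circleIntegrable_mul_mul hV p q')]
        simp only [eval_add, mul_add])
      (fun c p q => by
        rw [smul_eq_mul, ← circleMean_const_mul]
        simp only [eval_smul, smul_eq_mul, mul_left_comm _ c])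
  else 0

theorem pairing_apply {V : ℂ → ℂ} (hV : CircleIntegrable V 0 1) (p q : ℂ[X]) :
    pairing V p q = circleMean fun ζ => V ζ * p.eval ζ * q.eval ((starRingEnd ℂ) ζ) := by
  rw [pairing, dif_pos hV, LinearMap.mk₂_apply]

theorem mul_conj_of_norm_eq_one {ζ : ℂ} (hζ : ‖ζ‖ = 1) : ζ * (starRingEnd ℂ) ζ = 1 := by
  rw [Complex.mul_conj, Complex.normSq_eq_norm_sq, hζ]
  norm_num

theorem isToeplitz_pairing {V : ℂ → ℂ} (hV : CircleIntegrable V 0 1) : IsToeplitz (pairing V) := by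
  intro p q
  rw [pairing_apply hV, pairing_apply hV]
  refine circleMean_congr fun ζ hζ => ?_
  simp only [eval_mul, eval_X]
  linear_combination V ζ * p.eval ζ * q.eval ((starRingEnd ℂ) ζ) * mul_conj_of_norm_eq_one hζ

/-- Multiplying back by `ζ - a` recovers `W` except possibly at `ζ = a`, where the quotient is `0`
by convention; one point does not affect integrability. -/
theorem circleIntegrable_of_div_sub {W : ℂ → ℂ} {a : ℂ}
    (hV : CircleIntegrable (fun ζ => W ζ / (ζ - a)) 0 1) : CircleIntegrable W 0 1 := by
  refine CircleIntegrable.congr_codiscreteWithin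
    (eventuallyEq_codiscreteWithin_of_finite (Set.finite_singleton a) fun ζ _ hζa => ?_)
    (hV.fun_mul_continuousOn (g := fun ζ => ζ - a) (by fun_prop))
  exact div_mul_cancel₀ _ (sub_ne_zero.2 hζa)

theorem isCauchyTransform_pairing {W : ℂ → ℂ} {a : ℂ}
    (hV : CircleIntegrable (fun ζ => W ζ / (ζ - a)) 0 1) :
    IsCauchyTransform (pairing W) a (pairing fun ζ => W ζ / (ζ - a)) where
  toeplitz := isToeplitz_pairing hV
  sub_mul p q := by
    rw [pairing_apply hV, pairing_apply (circleIntegrable_of_div_sub hV)]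
    refine circleMean_congr_of_finite (Set.finite_singleton a) fun ζ _ hζa => ?_
    have : ζ - a ≠ 0 := sub_ne_zero.2 hζa
    simp only [eval_mul, eval_sub, eval_X, eval_C]
    field_simp

theorem IsBiorthonormalSystem.isBiorthogonal {W : ℂ → ℂ} {φ φbar : ℕ → ℂ[X]}
    (h : IsBiorthonormalSystem W φ φbar) (hW : CircleIntegrable W 0 1) :
    IsBiorthogonal (pairing W) φ φbar where
  natDegree_left := h.natDegree_left
  natDegree_right := h.natDegree_right
  leadingCoeff_eq := h.leadingCoeff_eq
  orthonormal k n := by rw [pairing_apply hW, h.orthonormal]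

/-! ### The functions `eps` and `epsStar` as Cauchy transforms. -/

section assoc

variable {W : ℂ → ℂ} {φ φbar : ℕ → ℂ[X]} {a : ℂ}

theorem caratheodory_eq (hV : CircleIntegrable (fun ζ => W ζ / (ζ - a)) 0 1) :
    caratheodory W a = pairing (fun ζ => W ζ / (ζ - a)) (X + C a) 1 := by
  rw [pairing_apply hV]
  refine circleMean_congr fun ζ _ => ?_
  simp only [eval_add, eval_X, eval_C, eval_one]
  ring

/-- Since (ζ + a) = 2ζ - (ζ - a), the integral with numerator ζ + a differs from the one with 2ζ by
B(φ_n, 1). That is zero for `n ≥ 1` and `1 / κ₀` for `n = 0`, where the convention for ψ₀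
compensates it. Only integrability is assumed, so `a` may lie on the circle. -/
theorem eps_eq (h : IsBiorthogonal (pairing W) φ φbar)
    (hV : CircleIntegrable (fun ζ => W ζ / (ζ - a)) 0 1) (n : ℕ) :
    eps W φ n a = IsBiorthogonal.assoc (pairing fun ζ => W ζ / (ζ - a)) φ n := by
  have hD := isCauchyTransform_pairing hV
  rw [eps, caratheodory_eq hV, IsBiorthogonal.assoc]
  have h1 := hD.X_mul (φ n) 1
  have h2 : pairing W (φ n) 1 = if n = 0 then 1 / (φ 0).leadingCoeff else 0 := by
    rw [h.left_eq (by simp), coeff_one]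
    split_ifs with hn
    · rw [hn]
    · rw [zero_div]
  have h3 : pairing (fun ζ => W ζ / (ζ - a)) ((X + C a) * φ n) 1
      = 2 * pairing (fun ζ => W ζ / (ζ - a)) (X * φ n) 1
        - if n = 0 then 1 / (φ 0).leadingCoeff else 0 := by
    rw [add_mul, map_add, LinearMap.add_apply, apply_C_mul, ← h2]
    linear_combination -h1
  rw [psi]
  split_ifs at h3 ⊢ with hn
  · have h4 : φ n = C ((φ n).eval a) := by
      rw [eq_C_of_natDegree_eq_zero ((h.natDegree_left n).trans hn), eval_C]
    rw [h4, mul_comm, apply_C_mul, ← h4] at h3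
    linear_combination h3
  · have h4 : circleMean (fun ζ => (ζ + a) / (ζ - a) * W ζ * ((φ n).eval ζ - (φ n).eval a))
        = pairing (fun ζ => W ζ / (ζ - a)) ((X + C a) * (φ n - C ((φ n).eval a))) 1 := by
      rw [pairing_apply hV]
      refine circleMean_congr fun ζ _ => ?_
      simp only [eval_add, eval_mul, eval_sub, eval_X, eval_C, eval_one]
      ring
    rw [h4, mul_sub, map_sub, LinearMap.sub_apply, h3, mul_comm _ (C _), apply_C_mul]
    ring

theorem epsStar_eq (h : IsBiorthogonal (pairing W) φ φbar)
    (hV : CircleIntegrable (fun ζ => W ζ / (ζ - a)) 0 1) (n : ℕ) :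
    epsStar W φbar n a = IsBiorthogonal.assocStar (pairing fun ζ => W ζ / (ζ - a)) φ φbar n := by
  have hD := isCauchyTransform_pairing hV
  rw [epsStar, caratheodory_eq hV, psiStar, recip]
  split_ifs with hn
  · have h1 : (φbar n).reflect n = C (φ n).leadingCoeff := by
      rw [hn, eq_C_of_natDegree_eq_zero (h.natDegree_right 0), h.coeff_right, reflect_C, pow_zero,
        mul_one]
    have h2 : φ n = C (φ n).leadingCoeff := by
      conv_lhs => rw [eq_C_of_natDegree_eq_zero ((h.natDegree_left n).trans hn)]
      rw [← h.coeff_left, hn]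
    have h3 : pairing W (φ n) 1 = 1 / (φ n).leadingCoeff := by
      rw [h.left_eq (by simp), coeff_one, if_pos hn]
    have h4 := hD.X_mul (φ n) 1
    rw [h3] at h4
    rw [IsBiorthogonal.assocStar, h1, eval_C, h.leadingCoeff_eq, map_add, LinearMap.add_apply,
      ← h2, h4, ← mul_one (C a), apply_C_mul]
    have h5 : pairing (fun ζ => W ζ / (ζ - a)) (φ n) 1
        = (φ n).leadingCoeff * pairing (fun ζ => W ζ / (ζ - a)) 1 1 := by
      rw [← apply_C_mul, mul_one, ← h2]
    have h6 : pairing (fun ζ => W ζ / (ζ - a)) (X * φ n) 1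
        = (φ n).leadingCoeff * pairing (fun ζ => W ζ / (ζ - a)) X 1 := by
      rw [← apply_C_mul, ← h2, mul_comm]
    have h7 : (φ 0).leadingCoeff = (φ n).leadingCoeff := by rw [hn]
    rw [h6, h5] at h4
    rw [h5, h7]
    linear_combination -h4
  · have h4 : circleMean (fun ζ => (ζ + a) / (ζ - a) * W ζ *
          (a ^ n * (φbar n).eval ((starRingEnd ℂ) ζ) - ((φbar n).reflect n).eval a))
        = a ^ n * pairing (fun ζ => W ζ / (ζ - a)) (X + C a) (φbar n)
          - ((φbar n).reflect n).eval a * pairing (fun ζ => W ζ / (ζ - a)) (X + C a) 1 := by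
      rw [← smul_eq_mul, ← smul_eq_mul, ← map_smul, ← map_smul, ← map_sub, pairing_apply hV]
      refine circleMean_congr fun ζ _ => ?_
      simp only [eval_add, eval_sub, eval_X, eval_C, eval_one, eval_smul, smul_eq_mul]
      ring
    -- For `n ≥ 1` the polynomial `X + a` has no coefficient at `n + 1`, so only its value `2 * a`
    -- at `a` remains.
    rw [h4, h.assocStar_eq hD, h.cauchy_right_eq hD (by rw [natDegree_X_add_C]; omega), coeff_add,
      coeff_X, coeff_C, if_neg (by omega), if_neg (by omega), eval_add, eval_X, eval_C]
    ring

end assoc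

/-! ### Differentiability of the coefficients. -/

theorem differentiableAt_det {n : ℕ} {M : ℝ → Matrix (Fin n) (Fin n) ℂ} {t : ℝ}
    (hM : ∀ i j, DifferentiableAt ℝ (fun s => M s i j) t) :
    DifferentiableAt ℝ (fun s => (M s).det) t := by
  simp only [Matrix.det_apply']
  refine DifferentiableAt.fun_sum fun σ _ => DifferentiableAt.const_mul ?_ _
  exact DifferentiableAt.fun_finsetProd fun i _ => hM _ _

/-- The slope of `f` is the slope of `f ^ 2` divided by `f s + f t`, which tends to `2 * f t ≠ 0`;
continuity excludes jumps between the two square roots. -/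
theorem differentiableAt_of_sq {f : ℝ → ℂ} {t : ℝ} (hf : ContinuousAt f t) (h0 : f t ≠ 0)
    (h : DifferentiableAt ℝ (fun s => f s ^ 2) t) : DifferentiableAt ℝ f t := by
  have h2 := h.hasDerivAt.tendsto_slope
  have hsum : Tendsto (fun s => f s + f t) (𝓝[≠] t) (𝓝 (f t + f t)) :=
    (hf.mono_left nhdsWithin_le_nhds).add_const _
  have hne : f t + f t ≠ 0 := by
    rw [← two_mul]
    exact mul_ne_zero two_ne_zero h0
  refine HasDerivAt.differentiableAt (hasDerivAt_iff_tendsto_slope.2 ((h2.mul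
    (hsum.inv₀ hne)).congr' ?_))
  filter_upwards [hsum.eventually_ne hne] with s hs
  rw [slope_def_module, slope_def_module, Complex.real_smul, Complex.real_smul,
    show f s ^ 2 - f t ^ 2 = (f s - f t) * (f s + f t) by ring, mul_assoc, mul_assoc,
    mul_inv_cancel₀ hs, mul_one]

namespace IsBiorthogonal

theorem sum_coeff_mul {B : ℂ[X] →ₗ[ℂ] ℂ[X] →ₗ[ℂ] ℂ} {p q : ℕ → ℂ[X]} (h : IsBiorthogonal B p q)
    (n : ℕ) (r : ℂ[X]) :
    B (p n) r = ∑ k : Fin n, (p n).coeff k * B (X ^ (k : ℕ)) r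
      + (p n).leadingCoeff * B (X ^ n) r := by
  conv_lhs => rw [(p n).as_sum_range_C_mul_X_pow, h.natDegree_left, Finset.sum_range_succ]
  rw [map_add, LinearMap.add_apply, map_sum, LinearMap.sum_apply, apply_C_mul, h.coeff_left,
    Finset.sum_range]
  simp only [apply_C_mul]

/-- A null vector of the Gram matrix is the coefficient vector of a polynomial of degree below `n`
orthogonal to every `X ^ l` with `l < n`. -/
theorem det_ne_zero {B : ℂ[X] →ₗ[ℂ] ℂ[X] →ₗ[ℂ] ℂ} {p q : ℕ → ℂ[X]} (h : IsBiorthogonal B p q)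
    (n : ℕ) :
    (Matrix.of fun l k : Fin n => B (X ^ (k : ℕ)) (X ^ (l : ℕ))).det ≠ 0 := by
  intro h0
  obtain ⟨c, hc, hMc⟩ := Matrix.exists_mulVec_eq_zero_iff.2 h0
  apply hc
  have hcoeff : ∀ m : ℕ, (∑ k : Fin n, C (c k) * X ^ (k : ℕ)).coeff m
      = ∑ k : Fin n, if m = k then c k else 0 := by
    intro m
    simp only [finsetSum_coeff, coeff_C_mul_X_pow]
  have hr : ∑ k : Fin n, C (c k) * X ^ (k : ℕ) = 0 := by
    refine h.eq_zero_of_forall_X_pow (n := n) ((degree_lt_iff_coeff_zero _ _).2 fun m hm => ?_)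
      fun l hl => ?_
    · rw [hcoeff]
      exact Finset.sum_eq_zero fun k _ => if_neg (by have := k.2; omega)
    · rw [map_sum, LinearMap.sum_apply]
      have := congrFun hMc ⟨l, hl⟩
      simp only [Matrix.mulVec, dotProduct, Matrix.of_apply, Pi.zero_apply] at this
      simp only [apply_C_mul]
      rw [← this]
      exact Finset.sum_congr rfl fun k _ => mul_comm _ _
  ext k
  have := hcoeff k
  rw [hr, coeff_zero] at this
  rw [Pi.zero_apply, this, Finset.sum_eq_single k]
  · rw [if_pos rfl]
  · intro j _ hj
    exact if_neg fun h => hj (Fin.ext h.symm)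
  · intro hk
    exact absurd (Finset.mem_univ k) hk

variable {B : ℝ → ℂ[X] →ₗ[ℂ] ℂ[X] →ₗ[ℂ] ℂ} {p q : ℝ → ℕ → ℂ[X]} {t : ℝ} {n : ℕ}

/-- Orthogonality to `X ^ l`, `l < n`, is a linear system for the lower coefficients of the monic
polynomial; Cramer's rule writes each as a quotient of determinants of moments. -/
theorem differentiableAt_coeff_div (h : ∀ᶠ s in 𝓝 t, IsBiorthogonal (B s) (p s) (q s))
    (hB : ∀ i j, DifferentiableAt ℝ (fun s => B s (X ^ i) (X ^ j)) t) (k : Fin n) :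
    DifferentiableAt ℝ (fun s => (p s n).coeff k / (p s n).leadingCoeff) t := by
  set M : ℝ → Matrix (Fin n) (Fin n) ℂ := fun s =>
    Matrix.of fun l k : Fin n => B s (X ^ (k : ℕ)) (X ^ (l : ℕ)) with hM
  have hN : DifferentiableAt ℝ
      (fun s => ((M s).updateCol k fun l : Fin n => -(B s (X ^ n) (X ^ (l : ℕ)))).det) t := by
    refine differentiableAt_det fun i j => ?_
    simp only [Matrix.updateCol_apply]
    split_ifs
    · exact (hB _ _).neg
    · exact hB _ _
  have hD : DifferentiableAt ℝ (fun s => (M s).det) t := differentiableAt_det fun i j => hB _ _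
  refine (hN.div hD (h.self_of_nhds.det_ne_zero n)).congr_of_eventuallyEq ?_
  filter_upwards [h] with s hs
  rw [Pi.div_apply, eq_div_iff (hs.det_ne_zero n)]
  have hκ := hs.leadingCoeff_ne_zero n
  have hv : (M s).mulVec (fun k : Fin n => (p s n).coeff k / (p s n).leadingCoeff)
      = fun l : Fin n => -(B s (X ^ n) (X ^ (l : ℕ))) := by
    ext l
    have h1 := hs.sum_coeff_mul n (X ^ (l : ℕ))
    rw [hs.left_eq_zero (by rw [degree_X_pow]; exact_mod_cast l.2)] at h1
    refine mul_left_cancel₀ hκ ?_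
    rw [mul_neg, ← eq_neg_of_add_eq_zero_left h1.symm, Matrix.mulVec, dotProduct, Finset.mul_sum]
    refine Finset.sum_congr rfl fun k _ => ?_
    simp only [hM, Matrix.of_apply]
    field_simp
  change _ * (M s).det = _
  rw [← hv, ← Matrix.cramer_apply, Matrix.cramer_eq_adjugate_mulVec, Matrix.mulVec_mulVec,
    Matrix.adjugate_mul, Matrix.smul_mulVec, Matrix.one_mulVec, Pi.smul_apply, smul_eq_mul,
    mul_comm]

theorem differentiableAt_leadingCoeff (h : ∀ᶠ s in 𝓝 t, IsBiorthogonal (B s) (p s) (q s))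
    (hB : ∀ i j, DifferentiableAt ℝ (fun s => B s (X ^ i) (X ^ j)) t)
    (hκ : ContinuousAt (fun s => (p s n).leadingCoeff) t) :
    DifferentiableAt ℝ (fun s => (p s n).leadingCoeff) t := by
  have h0 := h.self_of_nhds.leadingCoeff_ne_zero n
  have hG : DifferentiableAt ℝ (fun s => ∑ k : Fin n, (p s n).coeff k / (p s n).leadingCoeff *
      B s (X ^ (k : ℕ)) (X ^ n) + B s (X ^ n) (X ^ n)) t :=
    (DifferentiableAt.fun_sum fun k _ => (differentiableAt_coeff_div h hB k).mul (hB _ _)).add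
      (hB _ _)
  -- The monic polynomial pairs with `X ^ n` to `1 / κ²`, so moments and monic coefficients
  -- determine κ only up to sign.
  have hGe : ∀ᶠ s in 𝓝 t, ∑ k : Fin n, (p s n).coeff k / (p s n).leadingCoeff *
      B s (X ^ (k : ℕ)) (X ^ n) + B s (X ^ n) (X ^ n) = ((p s n).leadingCoeff ^ 2)⁻¹ := by
    filter_upwards [h] with s hs
    have hκ := hs.leadingCoeff_ne_zero n
    have h1 := hs.sum_coeff_mul n (X ^ n)
    rw [hs.left_eq (by rw [natDegree_X_pow]), coeff_X_pow, if_pos rfl] at h1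
    have h2 : ∑ k : Fin n, (p s n).coeff k / (p s n).leadingCoeff * B s (X ^ (k : ℕ)) (X ^ n)
        = (∑ k : Fin n, (p s n).coeff k * B s (X ^ (k : ℕ)) (X ^ n)) / (p s n).leadingCoeff := by
      rw [Finset.sum_div]
      exact Finset.sum_congr rfl fun k _ => by ring
    rw [h2]
    field_simp at h1 ⊢
    linear_combination -h1
  refine differentiableAt_of_sq hκ h0 ((hG.inv ?_).congr_of_eventuallyEq ?_)
  · rw [hGe.self_of_nhds]
    exact inv_ne_zero (pow_ne_zero 2 h0)
  · filter_upwards [hGe] with s hs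
    rw [Pi.inv_apply, hs, inv_inv]

theorem differentiableAt_coeff (h : ∀ᶠ s in 𝓝 t, IsBiorthogonal (B s) (p s) (q s))
    (hB : ∀ i j, DifferentiableAt ℝ (fun s => B s (X ^ i) (X ^ j)) t)
    (hκ : ContinuousAt (fun s => (p s n).leadingCoeff) t) (k : ℕ) :
    DifferentiableAt ℝ (fun s => (p s n).coeff k) t := by
  have hd := differentiableAt_leadingCoeff h hB hκ
  rcases lt_trichotomy k n with hk | rfl | hk
  · refine ((differentiableAt_coeff_div h hB ⟨k, hk⟩).mul hd).congr_of_eventuallyEq ?_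
    filter_upwards [h] with s hs
    exact (div_mul_cancel₀ _ (hs.leadingCoeff_ne_zero n)).symm
  · refine hd.congr_of_eventuallyEq ?_
    filter_upwards [h] with s hs using hs.coeff_left k
  · refine (differentiableAt_const (0 : ℂ)).congr_of_eventuallyEq ?_
    filter_upwards [h] with s hs
    exact coeff_eq_zero_of_natDegree_lt (by rwa [hs.natDegree_left])

theorem differentiableAt_coeff_right (h : ∀ᶠ s in 𝓝 t, IsBiorthogonal (B s) (p s) (q s))
    (hB : ∀ i j, DifferentiableAt ℝ (fun s => B s (X ^ i) (X ^ j)) t)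
    (hκ : ContinuousAt (fun s => (p s n).leadingCoeff) t) (k : ℕ) :
    DifferentiableAt ℝ (fun s => (q s n).coeff k) t := by
  refine differentiableAt_coeff (B := fun s => (B s).flip) (p := q) (q := p)
    (h.mono fun s hs => hs.flip) (fun i j => hB j i) (hκ.congr ?_) k
  filter_upwards [h] with s hs using (hs.leadingCoeff_eq n).symm

end IsBiorthogonal

/-! ### Integrable power singularities on the circle. -/

theorem intervalIntegrable_abs_rpow {r : ℝ} (hr : -1 < r) (a b : ℝ) :
    IntervalIntegrable (fun θ : ℝ => |θ| ^ r) volume a b := by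
  refine intervalIntegrable_of_even (fun x => by rw [abs_neg]) fun x hx => ?_
  refine (intervalIntegral.intervalIntegrable_rpow' hr).congr_uIoo fun y hy => ?_
  rw [Set.uIoo_of_le hx.le] at hy
  change y ^ r = |y| ^ r
  rw [abs_of_pos hy.1]

/-- The chord |exp(iθ) - 1| = 2 |sin(θ/2)| is at least (2/π) |θ| on [-π, π], so the nonpositive
power is dominated by that of |θ|. -/
theorem circleIntegrable_norm_sub_one_rpow {r : ℝ} (hr : -1 < r) (hr0 : r ≤ 0) :
    IntervalIntegrable (fun θ : ℝ => ‖circleMap 0 1 θ - 1‖ ^ r) volume (-Real.pi) Real.pi := by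
  have hπ := Real.pi_pos
  refine ((intervalIntegrable_abs_rpow hr (-Real.pi) Real.pi).const_mul ((2 / Real.pi) ^ r)).mono_fun'
    ?_ ?_
  · refine Measurable.aestronglyMeasurable ?_
    exact (((measurable_circleMap 0 1).sub_const 1).norm).pow_const r
  · rw [EventuallyLE, ae_restrict_iff' measurableSet_uIoc]
    have h0 : ∀ᵐ θ : ℝ, θ ≠ 0 := by simp [ae_iff]
    filter_upwards [h0] with θ hθ0 hθ
    rw [Set.uIoc_of_le (by linarith)] at hθ
    have h1 : ‖circleMap 0 1 θ - 1‖ = ‖2 * Real.sin (θ / 2)‖ := by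
      rw [← Complex.norm_exp_I_mul_ofReal_sub_one, circleMap_zero, Complex.ofReal_one, one_mul,
        mul_comm]
    have h2 : 2 / Real.pi * |θ| ≤ ‖circleMap 0 1 θ - 1‖ := by
      have := Real.mul_abs_le_abs_sin (x := θ / 2) (by
        rw [abs_le]; constructor <;> linarith [hθ.1, hθ.2])
      rw [h1, Real.norm_eq_abs, abs_mul, abs_two]
      rw [abs_div, abs_two] at this
      linarith
    have hpos : 0 < |θ| := abs_pos.2 hθ0
    rw [Real.norm_of_nonneg (by positivity), ← Real.mul_rpow (by positivity) (abs_nonneg θ)]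
    exact Real.rpow_le_rpow_of_nonpos (by positivity) h2 hr0

theorem circleIntegrable_norm_sub_rpow {r : ℝ} (hr : -1 < r) (hr0 : r ≤ 0) (a : ℂ) :
    CircleIntegrable (fun ζ => ‖ζ - a‖ ^ r) 0 1 := by
  by_cases ha : ‖a‖ = 1
  · obtain ⟨α, rfl⟩ : ∃ α : ℝ, circleMap 0 1 α = a := by
      have : a ∈ Set.range (circleMap 0 1) := by rw [range_circleMap]; simpa using ha
      exact this
    have hper : Function.Periodic
        (fun θ : ℝ => ‖circleMap 0 1 θ - circleMap 0 1 α‖ ^ r) (2 * Real.pi) := fun θ => by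
      simp only [periodic_circleMap 0 1 θ]
    have h1 := (circleIntegrable_norm_sub_one_rpow hr hr0).comp_sub_right α
    have h2 : (fun θ : ℝ => ‖circleMap 0 1 (θ - α) - 1‖ ^ r)
        = fun θ : ℝ => ‖circleMap 0 1 θ - circleMap 0 1 α‖ ^ r := by
      funext θ
      congr 1
      have : circleMap 0 1 θ - circleMap 0 1 α
          = circleMap 0 1 α * (circleMap 0 1 (θ - α) - 1) := by
        simp only [circleMap_zero, Complex.ofReal_one, one_mul, mul_sub, mul_one,
          ← Complex.exp_add]
        push_cast
        ring_nf
      rw [this, norm_mul, norm_circleMap_zero, abs_one, one_mul]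
    rw [h2] at h1
    refine hper.intervalIntegrable Real.two_pi_pos.ne' (t := -Real.pi + α) ?_ _ _
    rwa [show -Real.pi + α + 2 * Real.pi = Real.pi + α by ring]
  · refine ContinuousOn.circleIntegrable zero_le_one fun ζ hζ => ?_
    refine ContinuousAt.continuousWithinAt (ContinuousAt.rpow_const (by fun_prop) (Or.inl ?_))
    rw [norm_ne_zero_iff, sub_ne_zero]
    rintro rfl
    exact ha (by simpa using hζ)

/-- The exponent `r` in (0, 1] treats singularities on and off the circle alike: division by `ζ - u
s` leaves the power `r - 1`, which is integrable and nonpositive. -/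
theorem exists_rpow_bounds {u : ℝ → ℂ} {t : ℝ} (hu : ContinuousAt u t) {ρ : ℝ}
    (hρ : ‖u t‖ = 1 → 0 < ρ) :
    ∃ r : ℝ, 0 < r ∧ r ≤ 1 ∧ ∃ M, 0 ≤ M ∧ ∀ᶠ s in 𝓝 t, ∀ ζ : ℂ, ‖ζ‖ = 1 →
      ‖ζ - u s‖ ^ ρ ≤ M ∧ ‖ζ - u s‖ ^ ρ ≤ M * ‖ζ - u s‖ ^ r := by
  by_cases h1 : ‖u t‖ = 1
  · have hρ0 := hρ h1
    refine ⟨min 1 ρ, lt_min one_pos hρ0, min_le_left _ _, 3 ^ ρ, by positivity, ?_⟩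
    have : ∀ᶠ s in 𝓝 t, ‖u s‖ < 2 := hu.norm.eventually_lt_const (by simp only [h1]; norm_num)
    filter_upwards [this] with s hs ζ hζ
    have h3 : ‖ζ - u s‖ ≤ 3 := (norm_sub_le _ _).trans (by linarith)
    have hx := norm_nonneg (ζ - u s)
    refine ⟨Real.rpow_le_rpow hx h3 hρ0.le, ?_⟩
    have hmin : min 1 ρ ≤ ρ := min_le_right _ _
    have hmin0 : 0 < min 1 ρ := lt_min one_pos hρ0
    calc ‖ζ - u s‖ ^ ρ = ‖ζ - u s‖ ^ (ρ - min 1 ρ) * ‖ζ - u s‖ ^ (min 1 ρ) := by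
          rw [← Real.rpow_add_of_nonneg hx (by linarith) hmin0.le, sub_add_cancel]
      _ ≤ 3 ^ ρ * ‖ζ - u s‖ ^ (min 1 ρ) := by
          gcongr
          calc ‖ζ - u s‖ ^ (ρ - min 1 ρ) ≤ 3 ^ (ρ - min 1 ρ) :=
                Real.rpow_le_rpow hx h3 (by linarith)
            _ ≤ 3 ^ ρ := Real.rpow_le_rpow_of_exponent_le (by norm_num) (by linarith)
  -- With half the distance from `u t` to the circle as margin, nearby `u s` stay at distance at
  -- least `c` from it. The sum `M₀` covers both signs of `ρ`, and the lower bound `c` allows `r =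
  -- 1`.
  · set c := |1 - ‖u t‖| / 2 with hc
    have hc0 : 0 < c := by
      have : 1 - ‖u t‖ ≠ 0 := fun h => h1 (by linarith)
      positivity
    set R := 1 + ‖u t‖ + c
    have hR : 0 < R := by positivity
    set M₀ := c ^ ρ + R ^ ρ
    have hM₀ : 0 ≤ M₀ := by positivity
    refine ⟨1, one_pos, le_rfl, M₀ + M₀ / c, by positivity, ?_⟩
    have : ∀ᶠ s in 𝓝 t, ‖u s - u t‖ < c := by
      have := hu.eventually (ball_mem_nhds _ hc0)
      simpa [dist_eq_norm] using this
    filter_upwards [this] with s hs ζ hζ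
    have e1 : ‖ζ - u t‖ ≤ ‖ζ - u s‖ + ‖u s - u t‖ := norm_sub_le_norm_sub_add_norm_sub _ _ _
    have e2 : |‖ζ‖ - ‖u t‖| ≤ ‖ζ - u t‖ := abs_norm_sub_norm_le _ _
    have e3 : ‖ζ - u s‖ ≤ ‖ζ - u t‖ + ‖u t - u s‖ := norm_sub_le_norm_sub_add_norm_sub _ _ _
    have e4 : ‖ζ - u t‖ ≤ ‖ζ‖ + ‖u t‖ := norm_sub_le _ _
    rw [hζ] at e2 e4
    rw [norm_sub_rev (u t)] at e3
    have hlow : c ≤ ‖ζ - u s‖ := by linarith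
    have hup : ‖ζ - u s‖ ≤ R := by linarith
    have hx : 0 < ‖ζ - u s‖ := hc0.trans_le hlow
    have hb : ‖ζ - u s‖ ^ ρ ≤ M₀ := by
      rcases le_total 0 ρ with h | h
      · exact (Real.rpow_le_rpow hx.le hup h).trans (le_add_of_nonneg_left (by positivity))
      · exact (Real.rpow_le_rpow_of_nonpos hc0 hlow h).trans
          (le_add_of_nonneg_right (by positivity))
    refine ⟨hb.trans (le_add_of_nonneg_right (by positivity)), hb.trans ?_⟩
    rw [Real.rpow_one, add_mul]
    have : M₀ ≤ M₀ / c * ‖ζ - u s‖ := by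
      rw [div_mul_eq_mul_div, le_div_iff₀ hc0]
      gcongr
    linarith [mul_nonneg hM₀ hx.le]

/-! ### Regularity of the weight and differentiation under the integral. -/

namespace IsSemiclassicalDeformation

variable {m : ℕ} {T : Set ℝ} {z : Fin m → ℝ → ℂ} {ρ : Fin m → ℂ} {w : ℝ → ℂ → ℂ} {t : ℝ}

/-- For each `j` only the factor of `z j` is kept as a power and all others are bounded by
constants, so singularities may coincide. -/
theorem exists_bounds (hT : IsOpen T) (hw : IsSemiclassicalDeformation T z ρ w) (ht : t ∈ T) :
    ∃ (r : Fin m → ℝ) (M : ℝ), (∀ j, 0 < r j ∧ r j ≤ 1) ∧ 0 ≤ M ∧ ∀ᶠ s in 𝓝 t, ∀ ζ : ℂ, ‖ζ‖ = 1 →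
      ‖w s ζ‖ ≤ M ∧ ∀ j, ‖w s ζ‖ ≤ M * ‖ζ - z j s‖ ^ r j := by
  have hz : ∀ j, ContinuousAt (z j) t := fun j =>
    ((hw.contDiffOn j).continuousOn.continuousAt (hT.mem_nhds ht))
  choose r hr0 hr1 M hM hb using fun j =>
    exists_rpow_bounds (hz j) (ρ := (ρ j).re) (hw.re_pos j t ht)
  obtain ⟨C, hC⟩ := hw.bounded t ht
  refine ⟨r, |C| * ∏ j, M j, fun j => ⟨hr0 j, hr1 j⟩,
    mul_nonneg (abs_nonneg C) (Finset.prod_nonneg fun j _ => hM j), ?_⟩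
  filter_upwards [hC, eventually_all.2 hb] with s hs hbs ζ hζ
  have hprod : ‖w s ζ‖ ≤ |C| * ∏ j, ‖ζ - z j s‖ ^ (ρ j).re :=
    (hs ζ hζ).trans (by gcongr; exact le_abs_self C)
  refine ⟨hprod.trans ?_, fun j => hprod.trans ?_⟩
  · gcongr with j
    exact (hbs j ζ hζ).1
  · rw [mul_assoc]
    gcongr
    rw [← Finset.mul_prod_erase _ _ (Finset.mem_univ j),
      ← Finset.mul_prod_erase _ M (Finset.mem_univ j), mul_right_comm]
    gcongr with k hk
    · exact mul_nonneg (hM j) (by positivity)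
    · exact (hbs j ζ hζ).2
    · exact (hbs k ζ hζ).1

/-- The logarithmic derivative of the weight. -/
noncomputable def logDeriv (z : Fin m → ℝ → ℂ) (ρ : Fin m → ℂ) (t : ℝ) (ζ : ℂ) : ℂ :=
  ∑ j, -(ρ j * deriv (z j) t) / (ζ - z j t)

/-- Freezing ζ in the local branch formula gives the time derivative, freezing `t` the continuity in
ζ. At the base point each principal power is taken at `1`, inside the slit plane. -/
theorem exists_branch (hT : IsOpen T) (hw : IsSemiclassicalDeformation T z ρ w) :
    ∃ E : Set ℂ, E.Finite ∧ ∀ t ∈ T, ∀ ζ : ℂ, ‖ζ‖ = 1 → ζ ∉ E → (∀ j, ζ ≠ z j t) →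
      HasDerivAt (fun s => w s ζ) (w t ζ * logDeriv z ρ t ζ) t ∧
      ContinuousWithinAt (w t) (sphere 0 1) ζ := by
  obtain ⟨E, hE, hb⟩ := hw.branch
  refine ⟨E, hE, fun t ht ζ hζ hζE hζz => ?_⟩
  have hev := hb t ht ζ hζ hζE hζz
  have hne : ∀ j, ζ - z j t ≠ 0 := fun j => sub_ne_zero.2 (hζz j)
  have hζs : ζ ∈ sphere (0 : ℂ) 1 := by simpa using hζ
  constructor
  · have h1 : ∀ᶠ s in 𝓝 t, w s ζ = w t ζ * ∏ j, ((ζ - z j s) / (ζ - z j t)) ^ ρ j :=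
      (hev.filter_mono (Filter.prod_mono le_rfl (pure_le_nhdsWithin hζs))).curry.mono
        fun s hs => by simpa using hs
    have hd : ∀ j, HasDerivAt (fun s => ((ζ - z j s) / (ζ - z j t)) ^ ρ j)
        (-(ρ j * deriv (z j) t) / (ζ - z j t)) t := by
      intro j
      have hz : HasDerivAt (z j) (deriv (z j) t) t :=
        (((hw.contDiffOn j).contDiffAt (hT.mem_nhds ht)).differentiableAt
          one_ne_zero).hasDerivAt
      have h2 := ((hz.const_sub ζ).div_const (ζ - z j t))
      have h3 := HasDerivAt.comp_of_eq t (hasDerivAt_id (1 : ℂ) |>.cpow_const (c := ρ j)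
        (Or.inl (by simp))) h2 (div_self (hne j)).symm
      refine h3.congr_deriv ?_
      simp only [id, Complex.one_cpow]
      ring
    have hp := (HasDerivAt.fun_finsetProd (u := Finset.univ) fun j _ => hd j).const_mul (w t ζ)
    refine (hp.congr_of_eventuallyEq h1).congr_deriv ?_
    congr 1
    refine Finset.sum_congr rfl fun j _ => ?_
    rw [Finset.prod_eq_one, one_smul]
    intro k _
    rw [div_self (hne k), Complex.one_cpow]
  · have h1 : ∀ᶠ ζ' in 𝓝[sphere 0 1] ζ,
        w t ζ' = w t ζ * ∏ j, ((ζ' - z j t) / (ζ - z j t)) ^ ρ j :=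
      eventually_pure.1 (hev.filter_mono (Filter.prod_mono (pure_le_nhds t) le_rfl)).curry
    refine ContinuousWithinAt.congr_of_eventuallyEq (ContinuousAt.continuousWithinAt ?_) h1 ?_
    · refine continuousAt_const.mul (tendsto_finsetProd _ fun j _ => ?_)
      refine ContinuousAt.cpow (by fun_prop) continuousAt_const ?_
      rw [div_self (hne j)]
      simp
    · rw [Finset.prod_eq_one, mul_one]
      intro k _
      rw [div_self (hne k), Complex.one_cpow]

end IsSemiclassicalDeformation

theorem ae_circleMap_notMem {S : Set ℂ} (hS : S.Finite) :
    ∀ᵐ θ : ℝ ∂volume.restrict (Set.uIoc 0 (2 * Real.pi)), circleMap 0 1 θ ∉ S :=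
  ae_restrict_of_ae ((hS.countable.preimage_circleMap 0 one_ne_zero).ae_notMem volume)

theorem aestronglyMeasurable_circleMap {V : ℂ → ℂ} {S : Set ℂ} (hS : S.Finite)
    (hV : ∀ ζ, ‖ζ‖ = 1 → ζ ∉ S → ContinuousWithinAt V (sphere 0 1) ζ) :
    AEStronglyMeasurable (fun θ : ℝ => V (circleMap 0 1 θ))
      (volume.restrict (Set.uIoc 0 (2 * Real.pi))) := by
  have hopen : IsOpen (circleMap 0 1 ⁻¹' S)ᶜ :=
    (hS.isClosed.preimage (continuous_circleMap 0 1)).isOpen_compl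
  have hcont : ContinuousOn (fun θ : ℝ => V (circleMap 0 1 θ)) (circleMap 0 1 ⁻¹' S)ᶜ := by
    intro θ hθ
    refine (hV (circleMap 0 1 θ) (by simp) hθ).comp
      (continuous_circleMap 0 1).continuousWithinAt fun θ' _ => ?_
    simp
  have h1 := hcont.aestronglyMeasurable (μ := volume) hopen.measurableSet
  have h2 : volume.restrict (circleMap 0 1 ⁻¹' S)ᶜ = volume :=
    Measure.restrict_eq_self_of_ae_mem
      ((hS.countable.preimage_circleMap 0 one_ne_zero).ae_notMem volume)
  rw [h2] at h1
  exact h1.restrict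

namespace IsSemiclassicalDeformation

variable {m : ℕ} {T : Set ℝ} {z : Fin m → ℝ → ℂ} {ρ : Fin m → ℂ} {w : ℝ → ℂ → ℂ} {t : ℝ}

theorem aestronglyMeasurable (hT : IsOpen T) (hw : IsSemiclassicalDeformation T z ρ w)
    (ht : t ∈ T) : AEStronglyMeasurable (fun θ : ℝ => w t (circleMap 0 1 θ))
      (volume.restrict (Set.uIoc 0 (2 * Real.pi))) := by
  obtain ⟨E, hE, hb⟩ := hw.exists_branch hT
  refine aestronglyMeasurable_circleMap (hE.union (Set.finite_range fun j => z j t))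
    fun ζ hζ hζS => (hb t ht ζ hζ (fun h => hζS (Or.inl h)) fun j h => hζS (Or.inr ⟨j, h.symm⟩)).2

theorem circleIntegrable_div_sub (hT : IsOpen T) (hw : IsSemiclassicalDeformation T z ρ w)
    (ht : t ∈ T) (j : Fin m) : CircleIntegrable (fun ζ => w t ζ / (ζ - z j t)) 0 1 := by
  obtain ⟨r, M, hr, hM, hb⟩ := hw.exists_bounds hT ht
  have hI := (circleIntegrable_norm_sub_rpow (r := r j - 1) (by linarith [(hr j).1])
    (by linarith [(hr j).2]) (z j t))
  refine IntervalIntegrable.mono_fun' (hI.const_mul M) ?_ ?_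
  · refine (hw.aestronglyMeasurable hT ht).div₀ (Measurable.aestronglyMeasurable ?_)
    exact (measurable_circleMap 0 1).sub_const _
  · filter_upwards [ae_circleMap_notMem (Set.finite_singleton (z j t))] with θ hθ
    have h0 : 0 < ‖circleMap 0 1 θ - z j t‖ := norm_pos_iff.2 (sub_ne_zero.2 hθ)
    rw [norm_div, div_le_iff₀ h0, mul_assoc, ← Real.rpow_add_one h0.ne', sub_add_cancel]
    exact (hb.self_of_nhds _ (by simp)).2 j

theorem circleIntegrable (hT : IsOpen T) (hw : IsSemiclassicalDeformation T z ρ w)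
    (ht : t ∈ T) : CircleIntegrable (w t) 0 1 := by
  obtain ⟨r, M, hr, hM, hb⟩ := hw.exists_bounds hT ht
  refine IntervalIntegrable.mono_fun' (intervalIntegrable_const (c := M))
    (hw.aestronglyMeasurable hT ht) (Eventually.of_forall fun θ => ?_)
  exact (hb.self_of_nhds _ (by simp)).1

theorem exists_lipschitz (hT : IsOpen T) (hw : IsSemiclassicalDeformation T z ρ w)
    (ht : t ∈ T) : ∃ K : ℝ, 0 < K ∧ ∀ᶠ s in 𝓝 t, ∀ j,
      ‖z j s - z j t‖ ≤ K * |s - t| ∧ ‖deriv (z j) s‖ ≤ K := by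
  have h1 : ∀ j, ∃ K : NNReal, ∃ U ∈ 𝓝 t, LipschitzOnWith K (z j) U := fun j =>
    ((hw.contDiffOn j).contDiffAt (hT.mem_nhds ht)).exists_lipschitzOnWith
  choose K U hU hK using h1
  refine ⟨∑ j, (K j : ℝ) + 1, by positivity, eventually_all.2 fun j => ?_⟩
  have hKj : (K j : ℝ) ≤ ∑ j, (K j : ℝ) + 1 :=
    (Finset.single_le_sum (f := fun j => (K j : ℝ)) (fun i _ => (K i).2)
      (Finset.mem_univ j)).trans (le_add_of_nonneg_right zero_le_one)
  filter_upwards [hU j, eventually_mem_nhds_iff.2 (hU j)] with s hs hs'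
  refine ⟨?_, (norm_deriv_le_of_lipschitzOn hs' (hK j)).trans hKj⟩
  have := (hK j).dist_le_mul s hs t (mem_of_mem_nhds (hU j))
  rw [dist_eq_norm, Real.dist_eq] at this
  exact this.trans (by gcongr)

/-- If ζ is far from all singularities compared with |s - t|, the mean value inequality applies, as
no singularity reaches ζ between the two times. If it is close to one, both values of the weight are
small there, and no derivative is needed. -/
theorem exists_difference_bound (hT : IsOpen T) (hw : IsSemiclassicalDeformation T z ρ w)
    (ht : t ∈ T) : ∃ (r A : Fin m → ℝ) (S : Set ℂ), S.Finite ∧ (∀ j, 0 < r j ∧ r j ≤ 1) ∧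
      ∃ U ∈ 𝓝 t, ∀ s ∈ U, ∀ ζ : ℂ, ‖ζ‖ = 1 → ζ ∉ S →
        ‖w s ζ - w t ζ‖ ≤ (∑ j, A j * ‖ζ - z j t‖ ^ (r j - 1)) * |s - t| := by
  obtain ⟨r, M, hr, hM, hb⟩ := hw.exists_bounds hT ht
  obtain ⟨K, hK, hl⟩ := hw.exists_lipschitz hT ht
  obtain ⟨E, hE, hd⟩ := hw.exists_branch hT
  obtain ⟨ε, hε, hball⟩ := Metric.eventually_nhds_iff_ball.1
    ((hb.and hl).and (hT.mem_nhds ht))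
  -- The first summand serves the mean value case, the second the case of a nearby singularity.
  set A : Fin m → ℝ := fun j => 2 * ‖ρ j‖ * K * M + 6 * M * K with hA
  have hA0 : ∀ j, 0 ≤ A j := fun j => by positivity
  refine ⟨r, A, E ∪ Set.range fun j => z j t, hE.union (Set.finite_range _), hr, ball t ε,
    ball_mem_nhds t hε, fun s hs ζ hζ hζS => ?_⟩
  have hζE : ζ ∉ E := fun h => hζS (Or.inl h)
  have hζz : ∀ j, ζ ≠ z j t := fun j h => hζS (Or.inr ⟨j, h.symm⟩)
  have hdpos : ∀ j, 0 < ‖ζ - z j t‖ := fun j => norm_pos_iff.2 (sub_ne_zero.2 (hζz j))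
  by_cases hcase : ∀ j, 2 * K * |s - t| ≤ ‖ζ - z j t‖
  · have hseg : ∀ u ∈ Set.uIcc t s, u ∈ ball t ε ∧ |u - t| ≤ |s - t| := by
      intro u hu
      have h1 := Set.abs_sub_left_of_mem_uIcc hu
      refine ⟨?_, h1⟩
      rw [mem_ball, Real.dist_eq] at hs ⊢
      exact h1.trans_lt hs
    have hfar : ∀ u ∈ Set.uIcc t s, ∀ j, ‖ζ - z j t‖ / 2 ≤ ‖ζ - z j u‖ := by
      intro u hu j
      have h1 := ((hball u (hseg u hu).1).1.2 j).1
      have h2 : ‖ζ - z j t‖ ≤ ‖ζ - z j u‖ + ‖z j u - z j t‖ :=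
        norm_sub_le_norm_sub_add_norm_sub _ _ _
      have h3 := mul_le_mul_of_nonneg_left (hseg u hu).2 hK.le
      have h4 := hcase j
      linarith
    have hderiv : ∀ u ∈ Set.uIcc t s,
        HasDerivWithinAt (fun s => w s ζ) (w u ζ * logDeriv z ρ u ζ) (Set.uIcc t s) u := by
      intro u hu
      refine (hd u (hball u (hseg u hu).1).2 ζ hζ hζE fun j hj => ?_).1.hasDerivWithinAt
      have := hfar u hu j
      rw [hj, sub_self, norm_zero] at this
      have h2 := hdpos j
      rw [hj] at h2
      linarith
    have hbound : ∀ u ∈ Set.uIcc t s, ‖w u ζ * logDeriv z ρ u ζ‖ ≤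
        ∑ j, A j * ‖ζ - z j t‖ ^ (r j - 1) := by
      intro u hu
      obtain ⟨⟨hwu, hlu⟩, -⟩ := hball u (hseg u hu).1
      rw [logDeriv, Finset.mul_sum]
      refine (norm_sum_le _ _).trans (Finset.sum_le_sum fun j _ => ?_)
      have hu0 : 0 < ‖ζ - z j u‖ := (half_pos (hdpos j)).trans_le (hfar u hu j)
      have hr1 : r j - 1 ≤ 0 := by linarith [(hr j).2]
      have h1 : ‖w u ζ‖ / ‖ζ - z j u‖ ≤ M * (2 * ‖ζ - z j t‖ ^ (r j - 1)) := by
        calc ‖w u ζ‖ / ‖ζ - z j u‖ ≤ M * ‖ζ - z j u‖ ^ (r j - 1) := by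
              rw [div_le_iff₀ hu0, mul_assoc, ← Real.rpow_add_one hu0.ne', sub_add_cancel]
              exact (hwu ζ hζ).2 j
          _ ≤ M * (‖ζ - z j t‖ / 2) ^ (r j - 1) := by
              gcongr M * ?_
              exact Real.rpow_le_rpow_of_nonpos (half_pos (hdpos j)) (hfar u hu j) hr1
          _ ≤ M * (2 * ‖ζ - z j t‖ ^ (r j - 1)) := by
              gcongr
              rw [div_eq_inv_mul, Real.mul_rpow (by norm_num) (hdpos j).le, Real.inv_rpow two_pos.le,
                ← Real.rpow_neg two_pos.le]
              gcongr
              exact (Real.rpow_le_rpow_of_exponent_le one_le_two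
                (by linarith [(hr j).1] : -(r j - 1) ≤ 1)).trans_eq (Real.rpow_one 2)
      calc ‖w u ζ * (-(ρ j * deriv (z j) u) / (ζ - z j u))‖
          = ‖ρ j‖ * ‖deriv (z j) u‖ * (‖w u ζ‖ / ‖ζ - z j u‖) := by
            rw [norm_mul, norm_div, norm_neg, norm_mul]
            ring
        _ ≤ ‖ρ j‖ * K * (M * (2 * ‖ζ - z j t‖ ^ (r j - 1))) := by
            gcongr
            exact (hlu j).2
        _ ≤ A j * ‖ζ - z j t‖ ^ (r j - 1) := by
            have : 0 ≤ 6 * M * K * ‖ζ - z j t‖ ^ (r j - 1) := by positivity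
            rw [hA]
            linarith
    have := (convex_uIcc t s).norm_image_sub_le_of_norm_hasDerivWithin_le hderiv hbound
      Set.left_mem_uIcc Set.right_mem_uIcc
    rwa [Real.norm_eq_abs] at this
  · push Not at hcase
    obtain ⟨j, hj⟩ := hcase
    have hst : 0 < |s - t| := by
      by_contra h
      have := (hdpos j).trans hj
      have h2 : |s - t| = 0 := le_antisymm (not_lt.1 h) (abs_nonneg _)
      rw [h2, mul_zero] at this
      exact this.false
    have hKst : 0 < K * |s - t| := by positivity
    obtain ⟨⟨hws, hls⟩, -⟩ := hball s hs
    have h1 : ‖ζ - z j s‖ ≤ 3 * K * |s - t| := by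
      have h2 : ‖ζ - z j s‖ ≤ ‖ζ - z j t‖ + ‖z j t - z j s‖ :=
        norm_sub_le_norm_sub_add_norm_sub _ _ _
      rw [norm_sub_rev (z j t)] at h2
      linarith [(hls j).1]
    have h2 : ‖w s ζ‖ ≤ M * (3 * K * |s - t|) ^ r j :=
      ((hws ζ hζ).2 j).trans (by gcongr; exact (hr j).1.le)
    have h3 : ‖w t ζ‖ ≤ M * (3 * K * |s - t|) ^ r j :=
      ((hb.self_of_nhds ζ hζ).2 j).trans (by gcongr; exacts [(hr j).1.le, by linarith])
    -- One full power of |s - t| is split off; the remaining exponent `r j - 1` is nonpositive, so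
    -- replacing the base by the smaller ‖ζ - z j t‖ increases it.
    have h4 : (3 * K * |s - t|) ^ r j ≤ ‖ζ - z j t‖ ^ (r j - 1) * (3 * K * |s - t|) := by
      have hp : 0 < 3 * K * |s - t| := by positivity
      calc (3 * K * |s - t|) ^ r j = (3 * K * |s - t|) ^ (r j - 1) * (3 * K * |s - t|) := by
            rw [← Real.rpow_add_one hp.ne', sub_add_cancel]
        _ ≤ _ := by
            gcongr ?_ * _
            exact Real.rpow_le_rpow_of_nonpos (hdpos j) (by linarith) (by linarith [(hr j).2])
    calc ‖w s ζ - w t ζ‖ ≤ ‖w s ζ‖ + ‖w t ζ‖ := norm_sub_le _ _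
      _ ≤ 2 * M * (‖ζ - z j t‖ ^ (r j - 1) * (3 * K * |s - t|)) := by
          have := mul_le_mul_of_nonneg_left h4 hM
          linarith
      _ ≤ A j * ‖ζ - z j t‖ ^ (r j - 1) * |s - t| := by
          have : 0 ≤ 2 * ‖ρ j‖ * K * M * ‖ζ - z j t‖ ^ (r j - 1) * |s - t| := by positivity
          rw [hA]
          linarith
      _ ≤ (∑ j, A j * ‖ζ - z j t‖ ^ (r j - 1)) * |s - t| := by
          gcongr
          exact Finset.single_le_sum (f := fun j => A j * ‖ζ - z j t‖ ^ (r j - 1))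
            (fun i _ => mul_nonneg (hA0 i) (by positivity)) (Finset.mem_univ j)

theorem circleIntegrable_mul_logDeriv (hT : IsOpen T) (hw : IsSemiclassicalDeformation T z ρ w)
    (ht : t ∈ T) : CircleIntegrable (fun ζ => w t ζ * logDeriv z ρ t ζ) 0 1 := by
  have : (fun ζ => w t ζ * logDeriv z ρ t ζ)
      = ∑ j, (-(ρ j * deriv (z j) t)) • fun ζ => w t ζ / (ζ - z j t) := by
    funext ζ
    simp only [logDeriv, Finset.mul_sum, Finset.sum_apply, Pi.smul_apply, smul_eq_mul]
    exact Finset.sum_congr rfl fun j _ => by ring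
  rw [this]
  exact CircleIntegrable.sum _ fun j _ => (hw.circleIntegrable_div_sub hT ht j).const_smul

/-- Differentiation under the integral sign. -/
theorem hasDerivAt_circleMean (hT : IsOpen T) (hw : IsSemiclassicalDeformation T z ρ w)
    (ht : t ∈ T) {f : ℂ → ℂ} (hf : ContinuousOn f (sphere 0 1)) :
    HasDerivAt (fun s => circleMean fun ζ => w s ζ * f ζ)
      (circleMean fun ζ => w t ζ * logDeriv z ρ t ζ * f ζ) t := by
  obtain ⟨r, A, S, hS, hr, U, hU, hbd⟩ := hw.exists_difference_bound hT ht
  obtain ⟨E, hE, hd⟩ := hw.exists_branch hT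
  obtain ⟨C, hC⟩ := (isCompact_sphere (0 : ℂ) 1).exists_bound_of_continuousOn hf
  have hf' : ContinuousOn f (sphere 0 |(1 : ℝ)|) := by rwa [abs_one]
  have hfm : AEStronglyMeasurable (fun θ : ℝ => f (circleMap 0 1 θ))
      (volume.restrict (Set.uIoc 0 (2 * Real.pi))) :=
    (hf.comp_continuous (continuous_circleMap 0 1) fun θ => by simp).aestronglyMeasurable
  have hFint := intervalIntegrable_iff.1
    ((hw.circleIntegrable hT ht).fun_mul_continuousOn hf')
  have hF'int := intervalIntegrable_iff.1
    ((hw.circleIntegrable_mul_logDeriv hT ht).fun_mul_continuousOn hf')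
  have hbound : IntegrableOn (fun θ : ℝ =>
      (∑ j, A j * ‖circleMap 0 1 θ - z j t‖ ^ (r j - 1)) * C) (Set.uIoc 0 (2 * Real.pi)) := by
    refine Integrable.mul_const (integrable_finsetSum _ fun j _ => Integrable.const_mul ?_ _) C
    exact intervalIntegrable_iff.1 (circleIntegrable_norm_sub_rpow (by linarith [(hr j).1])
      (by linarith [(hr j).2]) (z j t))
  -- This version compares only with the base time `t`, which is exactly what the difference bound
  -- controls; no domination of derivatives at nearby times is required.
  have key := hasFDerivAt_integral_of_dominated_loc_of_lip' (𝕜 := ℝ)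
    (F := fun s θ => w s (circleMap 0 1 θ) * f (circleMap 0 1 θ))
    (F' := fun θ => ContinuousLinearMap.toSpanSingleton ℝ
      (w t (circleMap 0 1 θ) * logDeriv z ρ t (circleMap 0 1 θ) * f (circleMap 0 1 θ)))
    (inter_mem hU (hT.mem_nhds ht)) (fun s hs => (hw.aestronglyMeasurable hT hs.2).mul hfm) hFint
    ((ContinuousLinearMap.toSpanSingletonCLE (𝕜 := ℝ) (E := ℂ)).continuous.comp_aestronglyMeasurable
      hF'int.aestronglyMeasurable) ?_ hbound ?_
  · have hI := ContinuousLinearMap.integral_comp_comm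
      ((ContinuousLinearMap.toSpanSingletonCLE (𝕜 := ℝ) (E := ℂ)) : ℂ →L[ℝ] ℝ →L[ℝ] ℂ) hF'int
    have h1 := key.2
    erw [hI] at h1
    have h2 := (h1.hasDerivAt).const_smul (2 * Real.pi)⁻¹
    simp only [circleMean, Real.circleAverage,
      intervalIntegral.integral_of_le Real.two_pi_pos.le]
    rw [Set.uIoc_of_le Real.two_pi_pos.le] at h2
    refine h2.congr_deriv ?_
    congr 1
    exact one_smul ℝ _
  · filter_upwards [ae_circleMap_notMem hS] with θ hθ s hs
    rw [← sub_mul, norm_mul, mul_right_comm]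
    gcongr
    · exact (norm_nonneg _).trans (hbd s hs.1 _ (by simp) hθ)
    · exact hbd s hs.1 _ (by simp) hθ
    · exact hC _ (by simp)
  · filter_upwards [ae_circleMap_notMem (hE.union (Set.finite_range fun j => z j t))] with θ hθ
    refine HasDerivAt.hasFDerivAt ?_
    exact (hd t ht _ (by simp) (fun h => hθ (Or.inl h))
      fun j h => hθ (Or.inr ⟨j, h.symm⟩)).1.mul_const _

end IsSemiclassicalDeformation

/-! ### Algebra of the deformation: kernel expansions and associated functions. -/

theorem zpow_neg_mul_pow {a : ℂ} (ha : a ≠ 0) (n : ℕ) : a ^ (-(n : ℤ)) * a ^ n = 1 := by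
  rw [← zpow_natCast, ← zpow_add₀ ha, neg_add_cancel, zpow_zero]

theorem zpow_one_sub {a : ℂ} (ha : a ≠ 0) (n : ℕ) : a ^ (1 - (n : ℤ)) = a * a ^ (-(n : ℤ)) := by
  rw [sub_eq_add_neg, zpow_add₀ ha, zpow_one]

namespace IsBiorthogonal

variable {B Dx : ℂ[X] →ₗ[ℂ] ℂ[X] →ₗ[ℂ] ℂ} {p q : ℕ → ℂ[X]} {n : ℕ} {ι : Type*} [Fintype ι]
  {a σ : ι → ℂ} {D : ι → ℂ[X] →ₗ[ℂ] ℂ[X] →ₗ[ℂ] ℂ} {P : ℂ[X]} {c x : ℂ}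

/-- Expansion of the derivative of a bi-orthogonal polynomial. -/
theorem eq_sum_kernel (h : IsBiorthogonal B p q) (hD : ∀ j, IsCauchyTransform B (a j) (D j))
    (hσ : ∀ j, a j = 0 → σ j = 0) (hPn : P.natDegree ≤ n)
    (hP : ∀ k ≤ n, B P (q k) = ∑ j, σ j * a j * D j (p n) (q k) - if k = n then c else 0) :
    P = C (-(c + ∑ j, σ j)) * p n
      + ∑ j, C (1 / 2 * σ j * a j ^ (-(n : ℤ)) * assoc (D j) p n) * kernel p q n (a j) := by
  have h1 : C (-(c + ∑ j, σ j)) * p n = ∑ k ∈ Finset.range (n + 1),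
      C (if k = n then -(c + ∑ j, σ j) else 0) * p k := by
    rw [Finset.sum_eq_single n]
    · rw [if_pos rfl]
    · intro k _ hk
      rw [if_neg hk, C_0, zero_mul]
    · intro hn
      exact absurd (Finset.self_mem_range_succ n) hn
  rw [h1]
  simp only [kernel, Finset.mul_sum]
  rw [Finset.sum_comm, ← Finset.sum_add_distrib]
  conv_lhs => rw [h.eq_sum hPn]
  refine Finset.sum_congr rfl fun k hk => ?_
  have hkn : k ≤ n := Finset.mem_range_succ_iff.1 hk
  simp only [← mul_assoc, ← C_mul]
  rw [← Finset.sum_mul, ← map_sum, ← add_mul, ← C_add, hP k hkn]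
  congr 2
  have h2 : ∀ j, σ j * a j * D j (p n) (q k)
      = 1 / 2 * σ j * a j ^ (-(n : ℤ)) * assoc (D j) p n * ((q k).reflect n).eval (a j)
        - if k = n then σ j else 0 := by
    intro j
    -- At the origin `σ j = 0` kills both sides, so the conventional value of `a j ^ (-n)` is
    -- irrelevant.
    by_cases ha : a j = 0
    · rw [hσ j ha]
      simp
    · have h3 := h.cauchy_right_left (hD j) ha hkn
      have h4 := zpow_neg_mul_pow ha n
      split_ifs at h3 ⊢ with hk
      · linear_combination 1 / 2 * σ j * a j ^ (-(n : ℤ)) * h3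
          - (σ j * a j * D j (p n) (q k) + σ j) * h4
      · linear_combination 1 / 2 * σ j * a j ^ (-(n : ℤ)) * h3
          - (σ j * a j * D j (p n) (q k)) * h4
  rw [Finset.sum_congr rfl fun j _ => h2 j, Finset.sum_sub_distrib]
  split_ifs with hk
  · ring
  · rw [Finset.sum_const_zero]
    ring

/-- Expansion of the derivative of a reciprocal bi-orthogonal polynomial. -/
theorem reflect_eq_sum_kernel (h : IsBiorthogonal B p q)
    (hD : ∀ j, IsCauchyTransform B (a j) (D j)) (hσ : ∀ j, a j = 0 → σ j = 0)
    (hB : IsToeplitz B) (hPn : P.natDegree ≤ n)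
    (hP : ∀ k ≤ n, B (p k) P = ∑ j, σ j * a j * D j (p k) (q n) - if k = n then c else 0) :
    P.reflect n = C (-c) * (q n).reflect n
      - ∑ j, C (1 / 2 * σ j * a j ^ (-(n : ℤ)) * assocStar (D j) p q n) * kernel p q n (a j) := by
  have h2 : ∀ k ≤ n, ∀ j, σ j * a j * D j (p k) (q n)
      = -(1 / 2 * σ j * a j ^ (-(n : ℤ)) * assocStar (D j) p q n) * (p k).eval (a j) := by
    intro k hkn j
    by_cases ha : a j = 0
    · rw [hσ j ha]
      simp
    · have h3 := h.cauchy_left_right (hD j) hkn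
      have h4 := zpow_neg_mul_pow ha n
      linear_combination 1 / 2 * σ j * a j ^ (-(n : ℤ)) * h3
        - (σ j * a j * D j (p k) (q n)) * h4
  refine Polynomial.funext fun x => ?_
  have hrefl : P.reflect n = ∑ k ∈ Finset.range (n + 1), C (B (p k) P) * (q k).reflect n := by
    ext i
    rw [coeff_reflect]
    conv_lhs => rw [h.flip.eq_sum hPn]
    simp only [finsetSum_coeff, coeff_C_mul, coeff_reflect, LinearMap.flip_apply]
  have h1 : -c * ((q n).reflect n).eval x = ∑ k ∈ Finset.range (n + 1),
      (if k = n then -c else 0) * ((q k).reflect n).eval x := by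
    rw [Finset.sum_eq_single n]
    · rw [if_pos rfl]
    · intro k _ hk
      rw [if_neg hk, zero_mul]
    · intro hn
      exact absurd (Finset.self_mem_range_succ n) hn
  -- Expanding in reflected `q k` yields a kernel based at `x` and evaluated at `a j`; symmetry
  -- brings it to the required form.
  have hsymm : ∀ j, (kernel p q n (a j)).eval x = (kernel p q n x).eval (a j) := fun j =>
    h.kernel_symm hB n
  simp only [hrefl, eval_sub, eval_mul, eval_C, eval_finsetSum, hsymm, h1]
  simp only [kernel, eval_finsetSum, eval_mul, eval_C, Finset.mul_sum]
  rw [Finset.sum_comm, ← Finset.sum_sub_distrib]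
  refine Finset.sum_congr rfl fun k hk => ?_
  have hkn : k ≤ n := Finset.mem_range_succ_iff.1 hk
  rw [hP k hkn, Finset.sum_congr rfl fun j _ => h2 k hkn j, sub_mul, Finset.sum_mul]
  have h5 : ∑ j, -(1 / 2 * σ j * a j ^ (-(n : ℤ)) * assocStar (D j) p q n) * (p k).eval (a j)
        * ((q k).reflect n).eval x
      = -∑ j, 1 / 2 * σ j * a j ^ (-(n : ℤ)) * assocStar (D j) p q n *
        (((q k).reflect n).eval x * (p k).eval (a j)) := by
    rw [← Finset.sum_neg_distrib]
    exact Finset.sum_congr rfl fun j _ => by ring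
  rw [h5]
  split_ifs <;> ring

/-- Partial fractions: the weight of `E` carries 1 / ((ζ - x)(ζ - a)), that of `D₂` carries 1 / (ζ -
x) and that of `D₁` carries 1 / (ζ - a). -/
theorem resolvent {D₁ D₂ E : ℂ[X] →ₗ[ℂ] ℂ[X] →ₗ[ℂ] ℂ} {a x : ℂ} (h₁ : IsCauchyTransform D₁ x E)
    (h₂ : IsCauchyTransform D₂ a E) (hx : x ≠ a) (r s : ℂ[X]) :
    E r s = (D₂ r s - D₁ r s) / (x - a) := by
  have e1 := h₁.X_mul r s
  have e2 := h₂.X_mul r s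
  rw [eq_div_iff (sub_ne_zero.2 hx)]
  linear_combination e2 - e1

theorem eval_sum_kernel (h : IsBiorthogonal B p q) (hB : IsToeplitz B)
    (hσ : ∀ j, a j = 0 → σ j = 0) (hx : ∀ j, x ≠ a j) (e : ι → ℂ) :
    (∑ j, C (1 / 2 * σ j * a j ^ (-(n : ℤ)) * e j) * kernel p q n (a j)).eval x
      = 1 / 2 * (∑ j, σ j * a j ^ (-(n : ℤ)) * e j * ((q n).reflect n).eval (a j)
          * (x / (x - a j))) * (p n).eval x
        - 1 / 2 * (∑ j, σ j * a j ^ (1 - (n : ℤ)) * e j * (p n).eval (a j)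
          * (1 / (x - a j))) * ((q n).reflect n).eval x := by
  rw [eval_finsetSum, Finset.mul_sum, Finset.mul_sum, Finset.sum_mul, Finset.sum_mul,
    ← Finset.sum_sub_distrib]
  refine Finset.sum_congr rfl fun j _ => ?_
  by_cases ha : a j = 0
  · rw [hσ j ha]
    simp
  have hxa := sub_ne_zero.2 (hx j)
  have h1 := congrArg (eval x) (h.christoffel_darboux hB n (a j))
  simp only [eval_mul, eval_sub, eval_X, eval_C] at h1
  rw [zpow_one_sub ha, eval_mul, eval_C, eq_div_of_mul_eq hxa ((mul_comm _ _).trans h1)]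
  field_simp

/-- The left side is the product rule for `2 * Dx (X * p n) 1`: `P` is the polynomial derivative and
the sum is that of the form. The identity holds for each `j` separately; the Casoratian at `a j`
trades the products with the reflected polynomial for those with `p n` and absorbs `σ j`. -/
theorem assoc_deriv (h : IsBiorthogonal B p q) (hD : ∀ j, IsCauchyTransform B (a j) (D j))
    (hDx : IsCauchyTransform B x Dx) (hσ : ∀ j, a j = 0 → σ j = 0) (hx : ∀ j, x ≠ a j)
    (hP : P = C (-(c + ∑ j, σ j)) * p n
      + ∑ j, C (1 / 2 * σ j * a j ^ (-(n : ℤ)) * assoc (D j) p n) * kernel p q n (a j)) :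
    2 * (Dx (X * P) 1 - ∑ j, σ j * a j * ((Dx (X * p n) 1 - D j (X * p n) 1) / (x - a j)))
      = (-c - 1 / 2 * ∑ j, σ j * a j ^ (-(n : ℤ)) * assocStar (D j) p q n * (p n).eval (a j)
          * (x / (x - a j))) * assoc Dx p n
        + (1 / 2 * ∑ j, σ j * a j ^ (1 - (n : ℤ)) * assoc (D j) p n * (p n).eval (a j)
          * (1 / (x - a j))) * assocStar Dx p q n := by
  have hterm : ∀ j, 1 / 2 * σ j * a j ^ (-(n : ℤ)) * assoc (D j) p n
        * (2 * Dx (X * kernel p q n (a j)) 1)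
      - σ j * a j * ((assoc Dx p n - assoc (D j) p n) / (x - a j)) - σ j * assoc Dx p n
      = -(1 / 2 * (σ j * a j ^ (-(n : ℤ)) * assocStar (D j) p q n * (p n).eval (a j)
          * (x / (x - a j))) * assoc Dx p n)
        + 1 / 2 * (σ j * a j ^ (1 - (n : ℤ)) * assoc (D j) p n * (p n).eval (a j)
          * (1 / (x - a j))) * assocStar Dx p q n := by
    intro j
    by_cases ha : a j = 0
    · rw [hσ j ha]
      simp
    have hxa := sub_ne_zero.2 (hx j)
    have h1 := h.cauchy_kernel (hD j) hDx n
    have h2 := h.casoratian (hD j) n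
    have h3 := zpow_neg_mul_pow ha n
    rw [zpow_one_sub ha, eq_div_of_mul_eq hxa ((mul_comm _ _).trans h1)]
    field_simp
    linear_combination σ j * a j ^ (-(n : ℤ)) * (x * assoc Dx p n - a j * assoc (D j) p n) * h2
      + 2 * σ j * (x * assoc Dx p n - a j * assoc (D j) p n) * h3
  have hsum := Finset.sum_congr (rfl : (Finset.univ : Finset ι) = Finset.univ)
    fun j _ => hterm j
  simp only [Finset.sum_sub_distrib, Finset.sum_add_distrib, Finset.sum_neg_distrib,
    ← Finset.sum_mul, ← Finset.mul_sum] at hsum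
  have e1 : 2 * ∑ j, σ j * a j * ((Dx (X * p n) 1 - D j (X * p n) 1) / (x - a j))
      = ∑ j, σ j * a j * ((assoc Dx p n - assoc (D j) p n) / (x - a j)) := by
    rw [Finset.mul_sum]
    refine Finset.sum_congr rfl fun j _ => ?_
    rw [assoc, assoc]
    ring
  have e2 : 2 * Dx (X * P) 1 = -(c + ∑ j, σ j) * assoc Dx p n
      + ∑ j, 1 / 2 * σ j * a j ^ (-(n : ℤ)) * assoc (D j) p n
        * (2 * Dx (X * kernel p q n (a j)) 1) := by
    rw [hP, mul_add, Finset.mul_sum, map_add, LinearMap.add_apply, map_sum, LinearMap.sum_apply,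
      mul_left_comm, apply_C_mul, mul_add, Finset.mul_sum, assoc]
    congr 1
    · ring
    · refine Finset.sum_congr rfl fun j _ => ?_
      rw [mul_left_comm, apply_C_mul]
      ring
  rw [mul_sub, e1, e2]
  linear_combination hsum

/-- The same mechanism; with `c` the logarithmic derivative of κ, the term `-c * (2 / κ)` is the
derivative of the `2 / κ` in `assocStar`. -/
theorem assocStar_deriv (h : IsBiorthogonal B p q) (hD : ∀ j, IsCauchyTransform B (a j) (D j))
    (hDx : IsCauchyTransform B x Dx) (hσ : ∀ j, a j = 0 → σ j = 0) (hx : ∀ j, x ≠ a j)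
    (hP : P = C (-c) * (q n).reflect n
      - ∑ j, C (1 / 2 * σ j * a j ^ (-(n : ℤ)) * assocStar (D j) p q n) * kernel p q n (a j)) :
    -c * (2 / (p n).leadingCoeff) - 2 * (Dx (X * P) 1 - ∑ j, σ j * a j *
        ((Dx (X * (q n).reflect n) 1 - D j (X * (q n).reflect n) 1) / (x - a j)))
      = (-c - 1 / 2 * ∑ j, σ j * a j ^ (1 - (n : ℤ)) * assoc (D j) p n
          * ((q n).reflect n).eval (a j) * (1 / (x - a j))) * assocStar Dx p q n
        + (1 / 2 * ∑ j, σ j * a j ^ (-(n : ℤ)) * assocStar (D j) p q n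
          * ((q n).reflect n).eval (a j) * (x / (x - a j))) * assoc Dx p n := by
  have hterm : ∀ j, 1 / 2 * σ j * a j ^ (-(n : ℤ)) * assocStar (D j) p q n
        * (2 * Dx (X * kernel p q n (a j)) 1)
      + σ j * a j * ((assocStar (D j) p q n - assocStar Dx p q n) / (x - a j))
      = -(1 / 2 * (σ j * a j ^ (1 - (n : ℤ)) * assoc (D j) p n * ((q n).reflect n).eval (a j)
          * (1 / (x - a j))) * assocStar Dx p q n)
        + 1 / 2 * (σ j * a j ^ (-(n : ℤ)) * assocStar (D j) p q n * ((q n).reflect n).eval (a j)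
          * (x / (x - a j))) * assoc Dx p n := by
    intro j
    by_cases ha : a j = 0
    · rw [hσ j ha]
      simp
    have hxa := sub_ne_zero.2 (hx j)
    have h1 := h.cauchy_kernel (hD j) hDx n
    have h2 := h.casoratian (hD j) n
    have h3 := zpow_neg_mul_pow ha n
    rw [zpow_one_sub ha, eq_div_of_mul_eq hxa ((mul_comm _ _).trans h1)]
    field_simp
    linear_combination σ j * a j * a j ^ (-(n : ℤ)) *
      (assocStar Dx p q n - assocStar (D j) p q n) * h2
      + 2 * σ j * a j * (assocStar Dx p q n - assocStar (D j) p q n) * h3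
  have hsum := Finset.sum_congr (rfl : (Finset.univ : Finset ι) = Finset.univ)
    fun j _ => hterm j
  simp only [Finset.sum_add_distrib, Finset.sum_neg_distrib,
    ← Finset.sum_mul, ← Finset.mul_sum] at hsum
  have e1 : 2 * ∑ j, σ j * a j *
        ((Dx (X * (q n).reflect n) 1 - D j (X * (q n).reflect n) 1) / (x - a j))
      = ∑ j, σ j * a j * ((assocStar (D j) p q n - assocStar Dx p q n) / (x - a j)) := by
    rw [Finset.mul_sum]
    refine Finset.sum_congr rfl fun j _ => ?_
    rw [assocStar, assocStar]
    ring
  have e2 : 2 * Dx (X * P) 1 = -c * (2 / (p n).leadingCoeff - assocStar Dx p q n)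
      - ∑ j, 1 / 2 * σ j * a j ^ (-(n : ℤ)) * assocStar (D j) p q n
        * (2 * Dx (X * kernel p q n (a j)) 1) := by
    rw [hP, mul_sub, Finset.mul_sum, map_sub, LinearMap.sub_apply, map_sum, LinearMap.sum_apply,
      mul_left_comm, apply_C_mul, mul_sub, Finset.mul_sum, assocStar]
    congr 1
    · ring
    · refine Finset.sum_congr rfl fun j _ => ?_
      rw [mul_left_comm, apply_C_mul]
      ring
  rw [mul_sub, e1, e2]
  linear_combination hsum

end IsBiorthogonal

/-! ### Derivatives of moving polynomials and pairings. -/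

theorem exists_polynomial_deriv {p : ℝ → ℂ[X]} {n : ℕ} {t : ℝ}
    (hdeg : ∀ᶠ s in 𝓝 t, (p s).natDegree ≤ n)
    (hp : ∀ k, DifferentiableAt ℝ (fun s => (p s).coeff k) t) :
    ∃ P : ℂ[X], P.natDegree ≤ n ∧ ∀ k, HasDerivAt (fun s => (p s).coeff k) (P.coeff k) t := by
  refine ⟨∑ k ∈ Finset.range (n + 1), C (deriv (fun s => (p s).coeff k) t) * X ^ k,
    natDegree_sum_le_of_forall_le _ _ fun k hk => (natDegree_C_mul_X_pow_le _ _).trans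
      (Finset.mem_range_succ_iff.1 hk), fun k => ?_⟩
  simp only [finsetSum_coeff, coeff_C_mul_X_pow, Finset.sum_ite_eq, Finset.mem_range_succ_iff]
  split_ifs with hk
  · exact (hp k).hasDerivAt
  · refine (hasDerivAt_const t (0 : ℂ)).congr_of_eventuallyEq ?_
    filter_upwards [hdeg] with s hs
    exact coeff_eq_zero_of_natDegree_lt (by omega)

theorem hasDerivAt_apply_polynomial {L : ℝ → ℂ[X] →ₗ[ℂ] ℂ} {L' : ℂ[X] →ₗ[ℂ] ℂ} {p : ℝ → ℂ[X]}
    {P : ℂ[X]} {n : ℕ} {t : ℝ} (hL : ∀ k, HasDerivAt (fun s => L s (X ^ k)) (L' (X ^ k)) t)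
    (hdeg : ∀ᶠ s in 𝓝 t, (p s).natDegree ≤ n) (hPn : P.natDegree ≤ n)
    (hP : ∀ k, HasDerivAt (fun s => (p s).coeff k) (P.coeff k) t) :
    HasDerivAt (fun s => L s (p s)) (L t P + L' (p t)) t := by
  have hsum : ∀ (Λ : ℂ[X] →ₗ[ℂ] ℂ) (r : ℂ[X]), r.natDegree ≤ n →
      Λ r = ∑ k ∈ Finset.range (n + 1), r.coeff k * Λ (X ^ k) := by
    intro Λ r hr
    conv_lhs => rw [r.as_sum_range_C_mul_X_pow' (Nat.lt_succ_of_le hr)]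
    rw [map_sum]
    refine Finset.sum_congr rfl fun k _ => ?_
    rw [← smul_eq_C_mul, map_smul, smul_eq_mul]
  rw [hsum (L t) P hPn, hsum L' (p t) hdeg.self_of_nhds, ← Finset.sum_add_distrib]
  refine (HasDerivAt.fun_sum fun k _ => (hP k).mul (hL k)).congr_of_eventuallyEq ?_
  filter_upwards [hdeg] with s hs
  exact hsum (L s) (p s) hs

theorem hasDerivAt_eval_polynomial {p : ℝ → ℂ[X]} {P : ℂ[X]} {n : ℕ} {t : ℝ}
    (hdeg : ∀ᶠ s in 𝓝 t, (p s).natDegree ≤ n) (hPn : P.natDegree ≤ n)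
    (hP : ∀ k, HasDerivAt (fun s => (p s).coeff k) (P.coeff k) t) (x : ℂ) :
    HasDerivAt (fun s => (p s).eval x) (P.eval x) t := by
  have := hasDerivAt_apply_polynomial (L := fun _ => leval x) (L' := 0)
    (fun k => hasDerivAt_const t _) hdeg hPn hP
  simpa using this

theorem pairing_sum {ι : Type*} [Fintype ι] {V : ι → ℂ → ℂ}
    (hV : ∀ j, CircleIntegrable (V j) 0 1) (c : ι → ℂ) (p q : ℂ[X]) :
    pairing (fun ζ => ∑ j, c j * V j ζ) p q = ∑ j, c j * pairing (V j) p q := by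
  have h1 : CircleIntegrable (fun ζ => ∑ j, c j * V j ζ) 0 1 := by
    have : (fun ζ => ∑ j, c j * V j ζ) = ∑ j, c j • V j := by
      funext ζ
      simp only [Finset.sum_apply, Pi.smul_apply, smul_eq_mul]
    rw [this]
    exact CircleIntegrable.sum _ fun j _ => (hV j).const_smul
  have h2 : ∀ j, CircleIntegrable
      (fun ζ => c j * (V j ζ * p.eval ζ * q.eval ((starRingEnd ℂ) ζ))) 0 1 := fun j =>
    (circleIntegrable_mul_mul (hV j) p q).const_smul
  rw [pairing_apply h1]
  simp only [pairing_apply (hV _), ← circleMean_const_mul]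
  rw [← circleMean_sum fun j _ => h2 j]
  refine circleMean_congr fun ζ _ => ?_
  rw [Finset.sum_mul, Finset.sum_mul]
  exact Finset.sum_congr rfl fun j _ => by ring

theorem continuousOn_inv_sub {x : ℂ} (hx : ‖x‖ ≠ 1) :
    ContinuousOn (fun ζ : ℂ => (ζ - x)⁻¹) (sphere 0 1) := by
  refine ContinuousOn.inv₀ (by fun_prop) fun ζ hζ => sub_ne_zero.2 ?_
  rintro rfl
  exact hx (by simpa using hζ)

theorem circleIntegrable_div_sub_of_norm_ne_one {V : ℂ → ℂ} (hV : CircleIntegrable V 0 1) {x : ℂ}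
    (hx : ‖x‖ ≠ 1) : CircleIntegrable (fun ζ => V ζ / (ζ - x)) 0 1 := by
  simp only [div_eq_mul_inv]
  exact hV.fun_mul_continuousOn (by rw [abs_one]; exact continuousOn_inv_sub hx)

/-- The coefficients `ρ j * ż j / z j` of the deformation derivatives. -/
noncomputable def logSpeed {m : ℕ} (z : Fin m → ℝ → ℂ) (ρ : Fin m → ℂ) (t : ℝ) (j : Fin m) : ℂ :=
  ρ j * (deriv (z j) t / z j t)

theorem logSpeed_eq_zero {m : ℕ} {z : Fin m → ℝ → ℂ} {ρ : Fin m → ℂ} {t : ℝ} {j : Fin m}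
    (h : z j t = 0) : logSpeed z ρ t j = 0 := by
  rw [logSpeed, h, div_zero, mul_zero]

namespace IsSemiclassicalDeformation

variable {m : ℕ} {T : Set ℝ} {z : Fin m → ℝ → ℂ} {ρ : Fin m → ℂ} {w : ℝ → ℂ → ℂ} {t : ℝ} {x : ℂ}

/-- Here the rest condition at the origin enters: without it the quotient by `z j t = 0` would lose
the velocity. -/
theorem logSpeed_mul (hw : IsSemiclassicalDeformation T z ρ w) (ht : t ∈ T) (j : Fin m) :
    logSpeed z ρ t j * z j t = ρ j * deriv (z j) t := by
  by_cases h : z j t = 0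
  · rw [h, hw.rest_at_zero j t ht h, mul_zero, mul_zero]
  · rw [logSpeed, mul_assoc, div_mul_cancel₀ _ h]

/-- The fixed factor `g` is used with value `1` for the pairing itself and `(ζ - x)⁻¹` for its
Cauchy transform. -/
theorem hasDerivAt_pairing_mul (hT : IsOpen T) (hw : IsSemiclassicalDeformation T z ρ w)
    (ht : t ∈ T) {g : ℂ → ℂ} (hg : ContinuousOn g (sphere 0 1)) (p q : ℂ[X]) :
    HasDerivAt (fun s => pairing (fun ζ => w s ζ * g ζ) p q)
      (pairing (fun ζ => w t ζ * logDeriv z ρ t ζ * g ζ) p q) t := by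
  have hg' : ContinuousOn g (sphere 0 |(1 : ℝ)|) := by rwa [abs_one]
  rw [pairing_apply ((hw.circleIntegrable_mul_logDeriv hT ht).fun_mul_continuousOn hg')]
  have := hw.hasDerivAt_circleMean hT ht
    (f := fun ζ => g ζ * p.eval ζ * q.eval ((starRingEnd ℂ) ζ))
    ((hg.mul p.continuous.continuousOn).mul (continuous_eval_conj q).continuousOn)
  simp only [← mul_assoc] at this
  refine this.congr_of_eventuallyEq ?_
  filter_upwards [hT.mem_nhds ht] with s hs
  rw [pairing_apply ((hw.circleIntegrable hT hs).fun_mul_continuousOn hg')]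

theorem hasDerivAt_pairing (hT : IsOpen T) (hw : IsSemiclassicalDeformation T z ρ w)
    (ht : t ∈ T) (p q : ℂ[X]) :
    HasDerivAt (fun s => pairing (w s) p q)
      (-∑ j, logSpeed z ρ t j * z j t * pairing (fun ζ => w t ζ / (ζ - z j t)) p q) t := by
  have h1 := hw.hasDerivAt_pairing_mul hT ht (g := fun _ => 1) continuousOn_const p q
  simp only [mul_one] at h1
  refine h1.congr_deriv ?_
  rw [← Finset.sum_neg_distrib]
  simp only [← neg_mul]
  rw [← pairing_sum fun j => hw.circleIntegrable_div_sub hT ht j]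
  congr 2
  refine congrArg pairing (_root_.funext fun ζ => ?_)
  rw [logDeriv, Finset.mul_sum]
  refine Finset.sum_congr rfl fun j _ => ?_
  rw [neg_mul, hw.logSpeed_mul ht]
  ring

theorem hasDerivAt_pairing_div (hT : IsOpen T) (hw : IsSemiclassicalDeformation T z ρ w)
    (ht : t ∈ T) (hx : ‖x‖ ≠ 1) (hxz : ∀ j, x ≠ z j t) (p q : ℂ[X]) :
    HasDerivAt (fun s => pairing (fun ζ => w s ζ / (ζ - x)) p q)
      (-∑ j, logSpeed z ρ t j * z j t * ((pairing (fun ζ => w t ζ / (ζ - x)) p q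
        - pairing (fun ζ => w t ζ / (ζ - z j t)) p q) / (x - z j t))) t := by
  have h1 := hw.hasDerivAt_pairing_mul hT ht (continuousOn_inv_sub hx) p q
  simp only [← div_eq_mul_inv] at h1
  refine h1.congr_deriv ?_
  have hV := fun j => circleIntegrable_div_sub_of_norm_ne_one
    (hw.circleIntegrable_div_sub hT ht j) hx
  have hres : ∀ j, (pairing (fun ζ => w t ζ / (ζ - x)) p q
        - pairing (fun ζ => w t ζ / (ζ - z j t)) p q) / (x - z j t)
      = pairing (fun ζ => w t ζ / (ζ - z j t) / (ζ - x)) p q := by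
    intro j
    refine (IsBiorthogonal.resolvent (isCauchyTransform_pairing (hV j)) ?_ (hxz j) p q).symm
    have h2 : (fun ζ => w t ζ / (ζ - z j t) / (ζ - x)) = fun ζ => w t ζ / (ζ - x) / (ζ - z j t) := by
      funext ζ
      exact div_right_comm _ _ _
    have h3 := hV j
    rw [h2] at h3 ⊢
    exact isCauchyTransform_pairing h3
  simp only [hres]
  rw [← Finset.sum_neg_distrib]
  simp only [← neg_mul]
  rw [← pairing_sum hV]
  congr 2
  refine congrArg pairing (_root_.funext fun ζ => ?_)
  rw [logDeriv, Finset.mul_sum, Finset.sum_div]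
  refine Finset.sum_congr rfl fun j _ => ?_
  rw [neg_mul, hw.logSpeed_mul ht]
  ring

end IsSemiclassicalDeformation

/-! ### The deformation equations. -/

theorem exists_deformation {m : ℕ} {T : Set ℝ} (hT : IsOpen T) {z : Fin m → ℝ → ℂ}
    {ρ : Fin m → ℂ} {w : ℝ → ℂ → ℂ} (hw : IsSemiclassicalDeformation T z ρ w)
    {φ φbar : ℝ → ℕ → ℂ[X]} (hφ : ∀ t ∈ T, IsBiorthonormalSystem (w t) (φ t) (φbar t))
    {n : ℕ} {t : ℝ} (hκ : ContinuousOn (fun t => (φ t n).leadingCoeff) T) (ht : t ∈ T) :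
    DifferentiableAt ℝ (fun s => (φ s n).leadingCoeff) t ∧
    (∃ P : ℂ[X], P.natDegree ≤ n ∧ (∀ k, HasDerivAt (fun s => (φ s n).coeff k) (P.coeff k) t) ∧
      P = C (-(deriv (fun s => (φ s n).leadingCoeff) t / (φ t n).leadingCoeff
          + ∑ j, logSpeed z ρ t j)) * φ t n
        + ∑ j, C (1 / 2 * logSpeed z ρ t j * z j t ^ (-(n : ℤ))
          * IsBiorthogonal.assoc (pairing fun ζ => w t ζ / (ζ - z j t)) (φ t) n)
          * IsBiorthogonal.kernel (φ t) (φbar t) n (z j t)) ∧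
    ∃ P : ℂ[X], P.natDegree ≤ n ∧
      (∀ k, HasDerivAt (fun s => (recip (φbar s) n).coeff k) (P.coeff k) t) ∧
      P = C (-(deriv (fun s => (φ s n).leadingCoeff) t / (φ t n).leadingCoeff))
          * (φbar t n).reflect n
        - ∑ j, C (1 / 2 * logSpeed z ρ t j * z j t ^ (-(n : ℤ))
          * IsBiorthogonal.assocStar (pairing fun ζ => w t ζ / (ζ - z j t)) (φ t) (φbar t) n)
          * IsBiorthogonal.kernel (φ t) (φbar t) n (z j t) := by
  have hB : ∀ s ∈ T, IsBiorthogonal (pairing (w s)) (φ s) (φbar s) := fun s hs =>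
    (hφ s hs).isBiorthogonal (hw.circleIntegrable hT hs)
  have hBev : ∀ᶠ s in 𝓝 t, IsBiorthogonal (pairing (w s)) (φ s) (φbar s) := by
    filter_upwards [hT.mem_nhds ht] with s hs using hB s hs
  have h := hB t ht
  have hd := fun p q => hw.hasDerivAt_pairing hT ht p q
  have hκt : ContinuousAt (fun s => (φ s n).leadingCoeff) t := hκ.continuousAt (hT.mem_nhds ht)
  have hdiff : ∀ i j : ℕ, DifferentiableAt ℝ (fun s => pairing (w s) (X ^ i) (X ^ j)) t :=
    fun i j => (hd _ _).differentiableAt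
  have hκd := IsBiorthogonal.differentiableAt_leadingCoeff hBev hdiff hκt
  have hdeg : ∀ᶠ s in 𝓝 t, (φ s n).natDegree ≤ n := hBev.mono fun s hs => (hs.natDegree_left n).le
  have hdeg' : ∀ᶠ s in 𝓝 t, (φbar s n).natDegree ≤ n :=
    hBev.mono fun s hs => (hs.natDegree_right n).le
  have hD := fun j => isCauchyTransform_pairing (hw.circleIntegrable_div_sub hT ht j)
  have hTo := isToeplitz_pairing (hw.circleIntegrable hT ht)
  have hκ0 := h.leadingCoeff_ne_zero n
  have hconst : ∀ c : ℂ, HasDerivAt (fun s => c / (φ s n).leadingCoeff)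
      (-(c * deriv (fun s => (φ s n).leadingCoeff) t / (φ t n).leadingCoeff ^ 2)) t := by
    intro c
    refine ((hasDerivAt_const t c).fun_div hκd.hasDerivAt hκ0).congr_deriv ?_
    ring
  refine ⟨hκd, ?_, ?_⟩
  · obtain ⟨P, hPn, hP⟩ := exists_polynomial_deriv hdeg
      (IsBiorthogonal.differentiableAt_coeff hBev hdiff hκt)
    refine ⟨P, hPn, hP, h.eq_sum_kernel hD (fun j => logSpeed_eq_zero) hPn fun k hk => ?_⟩
    -- The second argument is frozen at time `t`, so only the form and φ_n move. For every nearby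
    -- `s` the pairing equals a fixed coefficient over κ_n(s), and comparing the two derivatives
    -- gives the coordinates of `P`.
    have h1 := hasDerivAt_apply_polynomial (L := fun s => (pairing (w s)).flip (φbar t k))
      (L' := -∑ j, (logSpeed z ρ t j * z j t) •
        (pairing fun ζ => w t ζ / (ζ - z j t)).flip (φbar t k)) (fun i => by
          simpa using hd (X ^ i) (φbar t k)) hdeg hPn hP
    have h2 : HasDerivAt (fun s => (pairing (w s)).flip (φbar t k) (φ s n)) _ t :=
      (hconst ((φbar t k).coeff n)).congr_of_eventuallyEq (hBev.mono fun s hs => by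
        simp only [LinearMap.flip_apply]
        rw [hs.left_eq (by rwa [h.natDegree_right])])
    have h3 := h1.unique h2
    simp only [LinearMap.flip_apply, LinearMap.neg_apply, LinearMap.sum_apply,
      LinearMap.smul_apply, smul_eq_mul] at h3
    have h4 : (φbar t k).coeff n = if k = n then (φ t n).leadingCoeff else 0 := by
      split_ifs with hkn
      · rw [hkn, h.coeff_right]
      · exact coeff_eq_zero_of_natDegree_lt (by rw [h.natDegree_right]; omega)
    rw [h4] at h3
    split_ifs at h3 ⊢
    · have h5 : (φ t n).leadingCoeff * deriv (fun s => (φ s n).leadingCoeff) t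
          / (φ t n).leadingCoeff ^ 2
          = deriv (fun s => (φ s n).leadingCoeff) t / (φ t n).leadingCoeff := by
        field_simp
      linear_combination h3 - h5
    · linear_combination h3
  · obtain ⟨P, hPn, hP⟩ := exists_polynomial_deriv hdeg'
      (IsBiorthogonal.differentiableAt_coeff_right hBev hdiff hκt)
    refine ⟨P.reflect n, natDegree_reflect_le_of_le hPn, fun k => ?_,
      h.reflect_eq_sum_kernel hD (fun j => logSpeed_eq_zero) hTo hPn fun k hk => ?_⟩
    · simp only [recip, coeff_reflect]
      exact hP _
    have h1 := hasDerivAt_apply_polynomial (L := fun s => pairing (w s) (φ t k))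
      (L' := -∑ j, (logSpeed z ρ t j * z j t) •
        (pairing fun ζ => w t ζ / (ζ - z j t)) (φ t k)) (fun i => by
          simpa using hd (φ t k) (X ^ i)) hdeg' hPn hP
    have h2 : HasDerivAt (fun s => pairing (w s) (φ t k) (φbar s n)) _ t :=
      (hconst ((φ t k).coeff n)).congr_of_eventuallyEq (hBev.mono fun s hs => by
        beta_reduce
        rw [hs.right_eq (by rwa [h.natDegree_left])])
    have h3 := h1.unique h2
    simp only [LinearMap.neg_apply, LinearMap.sum_apply,
      LinearMap.smul_apply, smul_eq_mul] at h3
    have h4 : (φ t k).coeff n = if k = n then (φ t n).leadingCoeff else 0 := by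
      split_ifs with hkn
      · rw [hkn, h.coeff_left]
      · exact coeff_eq_zero_of_natDegree_lt (by rw [h.natDegree_left]; omega)
    rw [h4] at h3
    split_ifs at h3 ⊢
    · have h5 : (φ t n).leadingCoeff * deriv (fun s => (φ s n).leadingCoeff) t
          / (φ t n).leadingCoeff ^ 2
          = deriv (fun s => (φ s n).leadingCoeff) t / (φ t n).leadingCoeff := by
        field_simp
      linear_combination h3 - h5
    · linear_combination h3

end BiorthUnitCircle

/-- Deformation derivatives of the bi-orthonormal polynomials and associated functions.
Here `κₙ` is the leading coefficient of `φₙ`, chosen continuously in `t`.  For a singularity at rest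
at the origin `deriv (z j) t / z j t` is `0 / 0 = 0`, so that it does not contribute to the sums. -/
theorem mainTheorem8 {m : ℕ} (T : Set ℝ) (hT : IsOpen T) (z : Fin m → ℝ → ℂ) (ρ : Fin m → ℂ)
    (w : ℝ → ℂ → ℂ) (hw : IsSemiclassicalDeformation T z ρ w)
    (φ φbar : ℝ → ℕ → Polynomial ℂ)
    (hφ : ∀ t ∈ T, IsBiorthonormalSystem (w t) (φ t) (φbar t))
    (hκ : ∀ n, ContinuousOn (fun t => (φ t n).leadingCoeff) T)
    (n : ℕ) (t : ℝ) (ht : t ∈ T) :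
    DifferentiableAt ℝ (fun s => (φ s n).leadingCoeff) t ∧
    (∀ x : ℂ, (∀ j, x ≠ z j t) →
      HasDerivAt (fun s => (φ s n).eval x)
        ((-(deriv (fun s => (φ s n).leadingCoeff) t / (φ t n).leadingCoeff)
            - ∑ j, ρ j * (deriv (z j) t / z j t)
            + 1 / 2 * ∑ j, ρ j * (deriv (z j) t / z j t) * z j t ^ (-(n : ℤ))
                * eps (w t) (φ t) n (z j t) * (recip (φbar t) n).eval (z j t)
                * (x / (x - z j t))) * (φ t n).eval x
          - (1 / 2 * ∑ j, ρ j * (deriv (z j) t / z j t) * z j t ^ (1 - (n : ℤ))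
                * eps (w t) (φ t) n (z j t) * (φ t n).eval (z j t)
                * (1 / (x - z j t))) * (recip (φbar t) n).eval x) t ∧
      HasDerivAt (fun s => (recip (φbar s) n).eval x)
        ((-(deriv (fun s => (φ s n).leadingCoeff) t / (φ t n).leadingCoeff)
            + 1 / 2 * ∑ j, ρ j * (deriv (z j) t / z j t) * z j t ^ (1 - (n : ℤ))
                * epsStar (w t) (φbar t) n (z j t) * (φ t n).eval (z j t)
                * (1 / (x - z j t))) * (recip (φbar t) n).eval x
          - (1 / 2 * ∑ j, ρ j * (deriv (z j) t / z j t) * z j t ^ (-(n : ℤ))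
                * epsStar (w t) (φbar t) n (z j t) * (recip (φbar t) n).eval (z j t)
                * (x / (x - z j t))) * (φ t n).eval x) t) ∧
    (∀ x : ℂ, ‖x‖ ≠ 1 → (∀ j, x ≠ z j t) →
      HasDerivAt (fun s => eps (w s) (φ s) n x)
        ((-(deriv (fun s => (φ s n).leadingCoeff) t / (φ t n).leadingCoeff)
            - 1 / 2 * ∑ j, ρ j * (deriv (z j) t / z j t) * z j t ^ (-(n : ℤ))
                * epsStar (w t) (φbar t) n (z j t) * (φ t n).eval (z j t)
                * (x / (x - z j t))) * eps (w t) (φ t) n x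
          + (1 / 2 * ∑ j, ρ j * (deriv (z j) t / z j t) * z j t ^ (1 - (n : ℤ))
                * eps (w t) (φ t) n (z j t) * (φ t n).eval (z j t)
                * (1 / (x - z j t))) * epsStar (w t) (φbar t) n x) t ∧
      HasDerivAt (fun s => epsStar (w s) (φbar s) n x)
        ((-(deriv (fun s => (φ s n).leadingCoeff) t / (φ t n).leadingCoeff)
            - 1 / 2 * ∑ j, ρ j * (deriv (z j) t / z j t) * z j t ^ (1 - (n : ℤ))
                * eps (w t) (φ t) n (z j t) * (recip (φbar t) n).eval (z j t)
                * (1 / (x - z j t))) * epsStar (w t) (φbar t) n x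
          + (1 / 2 * ∑ j, ρ j * (deriv (z j) t / z j t) * z j t ^ (-(n : ℤ))
                * epsStar (w t) (φbar t) n (z j t) * (recip (φbar t) n).eval (z j t)
                * (x / (x - z j t))) * eps (w t) (φ t) n x) t) := by
  have hw_int := fun j => hw.circleIntegrable_div_sub hT ht j
  have hBev : ∀ᶠ s in 𝓝 t, s ∈ T ∧ IsBiorthogonal (pairing (w s)) (φ s) (φbar s) := by
    filter_upwards [hT.mem_nhds ht] with s hs
    exact ⟨hs, (hφ s hs).isBiorthogonal (hw.circleIntegrable hT hs)⟩
  have h := hBev.self_of_nhds.2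
  have hTo := isToeplitz_pairing (hw.circleIntegrable hT ht)
  have hD := fun j => isCauchyTransform_pairing (hw_int j)
  have hσ : ∀ j, z j t = 0 → logSpeed z ρ t j = 0 := fun j => logSpeed_eq_zero
  obtain ⟨hκd, ⟨P, hPn, hPd, hP⟩, Q, hQn, hQd, hQ⟩ := exists_deformation hT hw hφ (hκ n) ht
  have hdeg : ∀ᶠ s in 𝓝 t, (φ s n).natDegree ≤ n :=
    hBev.mono fun s hs => (hs.2.natDegree_left n).le
  have hdeg' : ∀ᶠ s in 𝓝 t, (recip (φbar s) n).natDegree ≤ n :=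
    hBev.mono fun s hs => natDegree_reflect_le_of_le (hs.2.natDegree_right n).le
  have heps : ∀ j, eps (w t) (φ t) n (z j t)
      = IsBiorthogonal.assoc (pairing fun ζ => w t ζ / (ζ - z j t)) (φ t) n := fun j =>
    eps_eq h (hw_int j) n
  have hepsStar : ∀ j, epsStar (w t) (φbar t) n (z j t)
      = IsBiorthogonal.assocStar (pairing fun ζ => w t ζ / (ζ - z j t)) (φ t) (φbar t) n := fun j =>
    epsStar_eq h (hw_int j) n
  have hlog : ∀ j, ρ j * (deriv (z j) t / z j t) = logSpeed z ρ t j := fun j => rfl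
  simp only [heps, hepsStar, hlog]
  refine ⟨hκd, fun x hx => ⟨?_, ?_⟩, fun x hx1 hx => ?_⟩
  · refine (hasDerivAt_eval_polynomial hdeg hPn hPd x).congr_deriv ?_
    rw [hP, Polynomial.eval_add, h.eval_sum_kernel hTo hσ hx, Polynomial.eval_mul,
      Polynomial.eval_C, recip]
    ring
  · refine (hasDerivAt_eval_polynomial hdeg' hQn hQd x).congr_deriv ?_
    rw [hQ, Polynomial.eval_sub, h.eval_sum_kernel hTo hσ hx, Polynomial.eval_mul,
      Polynomial.eval_C, recip]
    ring
  have hxint : ∀ s ∈ T, CircleIntegrable (fun ζ => w s ζ / (ζ - x)) 0 1 := fun s hs =>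
    circleIntegrable_div_sub_of_norm_ne_one (hw.circleIntegrable hT hs) hx1
  have hDx := isCauchyTransform_pairing (hxint t ht)
  have hcauchy := fun p q => hw.hasDerivAt_pairing_div hT ht hx1 hx p q
  -- Both associated functions at `x` are read off from this one moving functional: `2 * L φ_n` and
  -- `2 / κ_n - 2 * L φ*_n`.
  set L : ℝ → Polynomial ℂ →ₗ[ℂ] ℂ := fun s =>
    (pairing fun ζ => w s ζ / (ζ - x)).flip 1 ∘ₗ LinearMap.mulLeft ℂ Polynomial.X with hL
  set L' : Polynomial ℂ →ₗ[ℂ] ℂ := (-∑ j, (logSpeed z ρ t j * z j t / (x - z j t)) •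
    ((pairing fun ζ => w t ζ / (ζ - x)).flip 1
      - (pairing fun ζ => w t ζ / (ζ - z j t)).flip 1)) ∘ₗ LinearMap.mulLeft ℂ Polynomial.X with hL'
  have hL'_apply : ∀ p, L' p = -∑ j, logSpeed z ρ t j * z j t *
      ((pairing (fun ζ => w t ζ / (ζ - x)) (Polynomial.X * p) 1
        - pairing (fun ζ => w t ζ / (ζ - z j t)) (Polynomial.X * p) 1) / (x - z j t)) := by
    intro p
    simp only [hL', LinearMap.comp_apply, LinearMap.neg_apply, LinearMap.sum_apply,
      LinearMap.smul_apply, LinearMap.sub_apply, LinearMap.flip_apply, LinearMap.mulLeft_apply,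
      smul_eq_mul]
    congr 1
    exact Finset.sum_congr rfl fun j _ => by ring
  have hLd : ∀ k : ℕ, HasDerivAt (fun s => L s (Polynomial.X ^ k)) (L' (Polynomial.X ^ k)) t :=
    fun k => by
      rw [hL'_apply]
      exact hcauchy _ _
  constructor
  · rw [eps_eq h (hxint t ht), epsStar_eq h (hxint t ht),
      ← h.assoc_deriv hD hDx hσ hx hP]
    have h1 := (hasDerivAt_apply_polynomial hLd hdeg hPn hPd).const_mul 2
    rw [hL'_apply] at h1
    refine (h1.congr_of_eventuallyEq ?_).congr_deriv ?_
    · filter_upwards [hBev] with s hs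
      exact eps_eq hs.2 (hxint s hs.1) n
    · rw [← sub_eq_add_neg]
      rfl
  · rw [eps_eq h (hxint t ht), epsStar_eq h (hxint t ht)]
    refine HasDerivAt.congr_deriv ?_ (h.assocStar_deriv hD hDx hσ hx hQ)
    have h1 := (hasDerivAt_apply_polynomial hLd hdeg' hQn hQd).const_mul 2
    rw [hL'_apply] at h1
    have hκ0 := h.leadingCoeff_ne_zero n
    have h2 := ((hasDerivAt_const t (2 : ℂ)).fun_div hκd.hasDerivAt hκ0).sub h1
    refine (h2.congr_of_eventuallyEq ?_).congr_deriv ?_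
    · filter_upwards [hBev] with s hs
      exact epsStar_eq hs.2 (hxint s hs.1) n
    · rw [← sub_eq_add_neg]
      have h3 : (0 * (φ t n).leadingCoeff - 2 * deriv (fun s => (φ s n).leadingCoeff) t)
          / (φ t n).leadingCoeff ^ 2
          = -(deriv (fun s => (φ s n).leadingCoeff) t / (φ t n).leadingCoeff)
            * (2 / (φ t n).leadingCoeff) := by
        field_simp
        ring
      rw [h3]
      rfl
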